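/- **Setting.** Let $\mathcal X,\mathcal A$ be finite, $N,T\ge 1$, and let $p=(p_n)_{n=1}^N$ be transition kernels, $p_n(\cdot\mid x,a)\in\Delta_{\mathcal X}$. For a policy $\pi=(\pi_n)_{n=1}^N$, $\pi_n(\cdot\mid x)\in\Delta_{\mathcal A}$, let $P_\pi$ be the transition matrix on $\mathcal X\times\mathcal A$ of one episode, i.e. the product over $n=1,\dots,N$ of the matrices $\big(p_n(x'\mid x,a)\,\pi_n(a'\mid x')\big)_{(x,a),(x',a')}$. For a kernel $q$ and an initial vector $\nu$ let $\mu^{\pi,q,\nu}=(\mu_0,\dots,\mu_N)$ be given by $\mu_0=\nu$, $\mu_{n+1}(x,a)=\sum_{x',a'}\mu_n(x',a')q_{n+1}(x\mid x',a')\pi_{n+1}(a\mid x)$, and let $\mathcal M^q_\nu$ be the set of nonnegative sequences $(\mu_n)_{n=0}^N$ with $\mu_0=\nu$ and $\sum_a\mu_{n+1}(x,a)=\sum_{x',a'}\mu_n(x',a')q_{n+1}(x\mid x',a')$. Let $\rho\in\Delta_{\mathcal X\times\mathcal A}$. A policy is *periodic* if $\rho P_\pi=\rho$. Assume that a periodic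 policy exists and that for some $\alpha\in[0,1)$ every periodic policy satisfies $\|\nu P_\pi-\nu'P_\pi\|_1\le\alpha\|\nu-\nu'\|_1$ for all distributions $\nu,\nu'$. **Protocol (no resets).** Finitely many agents start i.i.d. from $\rho$. In episode $t=1,\dots,T$ all agents play the policy $\pi_t$, moving independently under $p$; each starts an episode where it ended the previous one. In each episode the trajectory $(x_{t,n},a_{t,n})_{n=0}^N$ of one selected agent is observed. The policy $\pi_t$ is a function of the learner's information $\mathcal F_t$ before episode $t$ (containing the previously observed trajectories). Put $\rho_1=\rho$, $\rho_{t+1}=\rho_tP_{\pi_t}$. The observations are independent in the sense that, given $\mathcal F_t$, the initial pair of the agent observed in episode $t$ is distributed according to $\rho_t$. **Algorithm MDPP-K.** Let $\delta\in(0,1)$, $\eta>0$. Let $N_{t,n}(x,a)$ and $M_{t,n}(x'\mid x,a)$ be the numbers of $s<t$ with $(x_{s,n},a_{s,n})=(x,a)$, respectively with also $x_{s,n+1}=x'$. Put $\hat p_{1,n+1}=1/|\mathcal X|$ and $\hat p_{t,n+1}(x'\mid x,a)=M_{t,n}(x'\mid x,a)/\max\{1,N_{t,n}(x,a)\}$ for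 $t\ge2$. For $0\le n<N$ put $b_{t,n}=C_\delta/\sqrt{\max\{1,N_{t,n}\}}$ with $C_\delta=\sqrt{2|\mathcal X|\log(|\mathcal X||\mathcal A|NT/\delta)}$, and $\bar b_{t,n}=\ell(N-n)\,b_{t,n}$. The losses $F_t(\mu)=\sum_{n=1}^N f_{t,n}(\mu_n)$, with $f_{t,n}$ convex and $\ell$-Lipschitz for $\|\cdot\|_1$, are arbitrary (possibly adaptive). Let $\mu_t=\mu^{\pi_t,\hat p_t,\rho_t}$, let $\ell_t$ be a (sub)gradient of $F_t$ at $\mu_t$, and let $D_\psi(\mu,\mu')=\psi(\mu)-\psi(\mu')-\langle\nabla\psi(\mu'),\mu-\mu'\rangle$ be any Bregman divergence. The first policy $\pi_1$ is arbitrary. For $1\le t<T$, whenever the constraint set below is non-empty, $\pi_{t+1}$ is a policy for which $\mu_{t+1}$ solves $$\mu_{t+1}\in\arg\min_{\mu\in\mathcal M^{\hat p_{t+1}}_{\rho_{t+1}}}\ \eta\langle\ell_t-\bar b_t,\mu\rangle+D_\psi(\mu,\mu_t)\quad\text{s.t.}\quad\|\mu_N-\rho\|_1\le\langle\mu,b_{t+1}\rangle+\alpha\|\rho_{t+1}-\rho\|_1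 ,$$ and $\pi_{t+1}$ is arbitrary otherwise. Here $\langle\mu,b\rangle=\sum_{n=0}^{N-1}\sum_{x,a}\mu_n(x,a)b_n(x,a)$. **Claim.** With probability at least $1-(2+T)\delta$, $$\sum_{t=1}^T\|\rho_{t+1}-\rho\|_1\le\frac{30N^2}{1-\alpha}|\mathcal X|^{3/2}\sqrt{|\mathcal A|T}\,\log\Big(\frac{|\mathcal X||\mathcal A|NT}{\delta}\Big)\sqrt{\log\Big(\frac N\delta\Big)} .$$ In particular, with high probability the sum is $\tilde O\big(N^2(1-\alpha)^{-1}|\mathcal X|^{3/2}\sqrt{|\mathcal A|T}\big)$. -/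

import Mathlib

open MeasureTheory ProbabilityTheory
open scoped Matrix

namespace PeriodicMDP

variable {X A J Ω : Type*} [Fintype X] [Fintype A] [DecidableEq X] [DecidableEq A]

/-- The `L₁` norm on functions on a finite set. -/
def l1 {ι : Type*} [Fintype ι] (v : ι → ℝ) : ℝ := ∑ i, |v i|

/-- Transition kernels: `p n (x, a) x₁` is the probability of moving from `(x, a)` at time step `n`
to `x₁` at time step `n + 1`, that is, `p_{n+1}(x₁ | x, a)`. -/
abbrev Kernel (X A : Type*) (N : ℕ) := Fin N → X × A → X → ℝ

/-- Policies: `π n x a` is the probability of action `a` in state `x` at time step `n + 1`,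
that is, `π_{n+1}(a | x)`. -/
abbrev Policy (X A : Type*) (N : ℕ) := Fin N → X → A → ℝ

/-- Sequences `μ_0, …, μ_N` of functions on state-action pairs. -/
abbrev Occ (X A : Type*) (N : ℕ) := Fin (N + 1) → X × A → ℝ

/-- Trajectories `(x_0, a_0), …, (x_N, a_N)` of one episode. -/
abbrev Traj (X A : Type*) (N : ℕ) := Fin (N + 1) → X × A

/-- Every row of `p` is a probability distribution on states. -/
def IsKernel {N : ℕ} (p : Kernel X A N) : Prop := ∀ n y, p n y ∈ stdSimplex ℝ X

/-- Every row of `π` is a probability distribution on actions. -/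
def IsPolicy {N : ℕ} (π : Policy X A N) : Prop := ∀ n x, π n x ∈ stdSimplex ℝ A

/-- One-step transition matrix on state-action pairs. -/
def stepMatrix {N : ℕ} (p : Kernel X A N) (π : Policy X A N) (n : Fin N) :
    Matrix (X × A) (X × A) ℝ :=
  Matrix.of fun y z => p n y z.1 * π n z.1 z.2

/-- The product of the first `n` one-step matrices. -/
def partialMatrix {N : ℕ} (p : Kernel X A N) (π : Policy X A N) (n : Fin (N + 1)) :
    Matrix (X × A) (X × A) ℝ :=
  Fin.induction (motive := fun _ => Matrix (X × A) (X × A) ℝ) 1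
    (fun i M => M * stepMatrix p π i) n

/-- The transition matrix `P_π` of a whole episode. -/
def episodeMatrix {N : ℕ} (p : Kernel X A N) (π : Policy X A N) : Matrix (X × A) (X × A) ℝ :=
  partialMatrix p π (Fin.last N)

/-- The state-action distribution sequence induced by `π` under the kernel `p` from the initial
distribution `ν`: `μ_0 = ν` and
`μ_{n+1}(x, a) = ∑_{y} μ_n(y) p_{n+1}(x | y) π_{n+1}(a | x)`. -/
def occ {N : ℕ} (p : Kernel X A N) (π : Policy X A N) (ν : X × A → ℝ) : Occ X A N := fun n =>
  Fin.induction (motive := fun _ => X × A → ℝ) ν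
    (fun i μ => fun z => ∑ y, μ y * (p i y z.1 * π i z.1 z.2)) n

/-- The set `M^p_ν` of nonnegative sequences that start at `ν` and satisfy the flow equations
of `p`. -/
def flowSet {N : ℕ} (p : Kernel X A N) (ν : X × A → ℝ) : Set (Occ X A N) :=
  {μ | (∀ n y, 0 ≤ μ n y) ∧ μ 0 = ν ∧
    ∀ (n : Fin N) (x : X), ∑ a, μ n.succ (x, a) = ∑ y, μ n.castSucc y * p n y x}

/-- A policy is periodic for `ρ` if `ρ P_π = ρ`. -/
def IsPeriodic {N : ℕ} (p : Kernel X A N) (ρ : X × A → ℝ) (π : Policy X A N) : Prop :=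
  IsPolicy π ∧ ρ ᵥ* episodeMatrix p π = ρ

/-- `P_π` is an `α`-contraction in `L₁` on distributions, for every periodic policy `π`. -/
def PeriodicContraction {N : ℕ} (p : Kernel X A N) (ρ : X × A → ℝ) (α : ℝ) : Prop :=
  ∀ π : Policy X A N, IsPeriodic p ρ π →
    ∀ ν ∈ stdSimplex ℝ (X × A), ∀ ν₁ ∈ stdSimplex ℝ (X × A),
      l1 (ν ᵥ* episodeMatrix p π - ν₁ ᵥ* episodeMatrix p π) ≤ α * l1 (ν - ν₁)

/-- The initial distributions of the episodes when nothing is reset: the first is `ρ`, the next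
one is obtained from the current one through `P_{π_t}`. Episodes are numbered from `0`. -/
def initDist {N : ℕ} (p : Kernel X A N) (ρ : X × A → ℝ) (π : ℕ → Policy X A N) : ℕ → X × A → ℝ
  | 0 => ρ
  | t + 1 => initDist p ρ π t ᵥ* episodeMatrix p (π t)

/-- Probability that an agent that starts at `z 0` and plays `π` follows the trajectory `z`. -/
def pathProb {N : ℕ} (p : Kernel X A N) (π : Policy X A N) (z : Traj X A N) : ℝ :=
  ∏ n : Fin N, stepMatrix p π n (z n.castSucc) (z n.succ)

/-! ### Estimation from the observed trajectories `o 0, o 1, …` -/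

/-- `N_{t,n}(y)`: visits of `y` at time step `n` before episode `t`. -/
def visits {N : ℕ} (o : ℕ → Traj X A N) (t : ℕ) (n : Fin N) (y : X × A) : ℕ :=
  ((Finset.range t).filter fun s => o s n.castSucc = y).card

/-- `M_{t,n}(x | y)`: visits of `y` at time step `n` followed by `x`, before episode `t`. -/
def moves {N : ℕ} (o : ℕ → Traj X A N) (t : ℕ) (n : Fin N) (y : X × A) (x : X) : ℕ :=
  ((Finset.range t).filter fun s => o s n.castSucc = y ∧ (o s n.succ).1 = x).card

/-- The estimated kernel of episode `t`: uniform in the first episode, then the ratio of the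
counts. -/
noncomputable def estKernel {N : ℕ} (o : ℕ → Traj X A N) (t : ℕ) : Kernel X A N := fun n y x =>
  if t = 0 then 1 / (Fintype.card X : ℝ)
  else (moves o t n y x : ℝ) / max 1 (visits o t n y : ℝ)

/-- `C_δ = √(2 |X| log(|X| |A| N T / δ))`. -/
noncomputable def bonusConst (X A : Type*) [Fintype X] [Fintype A] (N T : ℕ) (δ : ℝ) : ℝ :=
  Real.sqrt (2 * (Fintype.card X : ℝ) *
    Real.log ((Fintype.card X : ℝ) * (Fintype.card A : ℝ) * (N : ℝ) * (T : ℝ) / δ))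

/-- The bonus `b_{t,n}(y)`, `n = 0, …, N - 1`. -/
noncomputable def bonus {N : ℕ} (T : ℕ) (δ : ℝ) (o : ℕ → Traj X A N) (t : ℕ) (n : Fin N)
    (y : X × A) : ℝ :=
  bonusConst X A N T δ / Real.sqrt (max 1 (visits o t n y : ℝ))

/-- The pairing `⟨μ, b⟩ = ∑_{n=0}^{N-1} ∑_y μ_n(y) b_n(y)`. -/
def pairBonus {N : ℕ} (μ : Occ X A N) (b : Fin N → X × A → ℝ) : ℝ :=
  ∑ n : Fin N, ∑ y, μ n.castSucc y * b n y

/-! ### The constrained mirror descent step -/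

/-- The constraint set of the problem solved for episode `t`: sequences in `M^{p̂_t}_{ρ_t}` with
`‖μ_N - ρ‖₁ ≤ ⟨μ, b_t⟩ + α ‖ρ_t - ρ‖₁`. Here `π` is the sequence of policies (only those before
episode `t` matter) and `o` the sequence of observed trajectories. -/
def feasibleSet {N : ℕ} (p : Kernel X A N) (ρ : X × A → ℝ) (T : ℕ) (δ α : ℝ)
    (o : ℕ → Traj X A N) (π : ℕ → Policy X A N) (t : ℕ) : Set (Occ X A N) :=
  {μ | μ ∈ flowSet (estKernel o t) (initDist p ρ π t) ∧
    l1 (μ (Fin.last N) - ρ) ≤ pairBonus μ (bonus T δ o t) + α * l1 (initDist p ρ π t - ρ)}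

/-- `μ_t`, the sequence induced by `π_t` from `ρ_t` under the estimated kernel. -/
noncomputable def estOcc {N : ℕ} (p : Kernel X A N) (ρ : X × A → ℝ)
    (o : ℕ → Traj X A N) (π : ℕ → Policy X A N) (t : ℕ) : Occ X A N :=
  occ (estKernel o t) (π t) (initDist p ρ π t)

/-- The Bregman divergence `ψ(μ) - ψ(μ₀) - ⟨h, μ - μ₀⟩`, where `h` is the gradient of `ψ`
at `μ₀`. -/
def bregman {N : ℕ} (ψ : Occ X A N → ℝ) (h : Occ X A N) (μ μ₀ : Occ X A N) : ℝ :=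
  ψ μ - ψ μ₀ - ∑ n, ∑ y, h n y * (μ n y - μ₀ n y)

/-- `h` is the gradient of `ψ` at `μ₀`. Where `ψ` is not differentiable (as for entropies at
sequences with zero entries) nothing is required, so that every convention is covered. -/
def IsGradientAt {N : ℕ} (ψ : Occ X A N → ℝ) (h μ₀ : Occ X A N) : Prop :=
  DifferentiableAt ℝ ψ μ₀ → ∀ v : Occ X A N, fderiv ℝ ψ μ₀ v = ∑ n, ∑ y, h n y * v n y

/-- `g` is a subgradient of `f` at `u` (the gradient, if `f` is convex and differentiable). -/
def IsSubgradientAt {ι : Type*} [Fintype ι] (f : (ι → ℝ) → ℝ) (g u : ι → ℝ) : Prop :=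
  ∀ v, f u + ∑ i, g i * (v i - u i) ≤ f v

/-- The objective `η ⟨ℓ_t - b̄_t, μ⟩ + D_ψ(μ, μ_t)` minimized at the end of episode `t`. Here `g n`
is the gradient of `f_{t,n+1}` at `μ_{t,n+1}`, and `b̄_{t,n} = ℓ (N - n) b_{t,n}`, which vanishes
for `n = N`. -/
noncomputable def objective {N : ℕ} (T : ℕ) (δ η ℓ : ℝ) (ψ : Occ X A N → ℝ) (h : Occ X A N)
    (g : Fin N → X × A → ℝ) (o : ℕ → Traj X A N) (t : ℕ) (μ₀ μ : Occ X A N) : ℝ :=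
  η * (∑ n : Fin N, ∑ y, g n y * μ n.succ y
      - pairBonus μ (fun n y => ℓ * ((N : ℝ) - ((n : ℕ) : ℝ)) * bonus T δ o t n y))
    + bregman ψ h μ μ₀

/-! ### The online protocol and the algorithm -/

/-- The trajectories of the selected agents. -/
def observed {N : ℕ} (Z : ℕ → J → Ω → Traj X A N) (sel : ℕ → Ω → J) (ω : Ω) : ℕ → Traj X A N :=
  fun t => Z t (sel t ω) ω

/-- The multi-agent protocol without resets over the episodes `0, …, T - 1`. `Z t j` is the
trajectory of agent `j` in episode `t`, `sel t` the agent observed in episode `t`, `π t` the policy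
that all agents play in episode `t`; `ℱ t` is the information of the learner before episode `t`,
and `𝒢 t` records all that is settled when episode `t` starts. -/
structure IsProtocol [Fintype J] {mΩ : MeasurableSpace Ω} (P : Measure Ω) {N : ℕ}
    (p : Kernel X A N) (ρ : X × A → ℝ) (T : ℕ) (ℱ 𝒢 : Filtration ℕ mΩ)
    (Z : ℕ → J → Ω → Traj X A N) (sel : ℕ → Ω → J) (π : ℕ → Ω → Policy X A N) : Prop where
  info_le : ∀ t ≤ T, ℱ t ≤ 𝒢 t
  /-- The learner has seen the previously observed trajectories. -/
  observed_meas : ∀ t ≤ T, ∀ s < t, ∀ z : Traj X A N,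
    MeasurableSet[ℱ t] {ω | observed Z sel ω s = z}
  /-- The learner plays policies, chosen from its information. -/
  policy : ∀ t < T, ∀ ω, IsPolicy (π t ω)
  policy_meas : ∀ t < T, Measurable[ℱ t] (π t)
  past_meas : ∀ t ≤ T, ∀ s < t, ∀ (j : J) (z : Traj X A N), MeasurableSet[𝒢 t] {ω | Z s j ω = z}
  start_meas : ∀ t < T, ∀ (j : J) (y : X × A), MeasurableSet[𝒢 t] {ω | Z t j ω 0 = y}
  sel_meas : ∀ t < T, ∀ j : J, MeasurableSet[𝒢 t] {ω | sel t ω = j}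
  /-- In the first episode the agents start independently of each other from `ρ`. -/
  start : ∀ y : J → X × A, P.real {ω | ∀ j, Z 0 j ω 0 = y j} = ∏ j, ρ (y j)
  /-- No reset: an agent starts an episode where it ended the previous one. -/
  carry : ∀ t, t + 1 < T → ∀ (j : J) (ω : Ω), Z (t + 1) j ω 0 = Z t j ω (Fin.last N)
  /-- During an episode the agents move independently of each other, following the kernel `p`
  and the policy `π t`. -/
  move : ∀ t < T, ∀ z : J → Traj X A N,
    P⟦{ω | ∀ j, Z t j ω = z j} | 𝒢 t⟧ =ᵐ[P]
      Set.indicator {ω | ∀ j, Z t j ω 0 = z j 0} (fun ω => ∏ j, pathProb p (π t ω) (z j))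
  /-- The agent to be observed is selected such that its current state-action pair is a sample
  from `ρ_t` that is independent of the previous observations. -/
  indep : ∀ t < T, ∀ y : X × A,
    P⟦{ω | Z t (sel t ω) ω 0 = y} | ℱ t⟧ =ᵐ[P] fun ω => initDist p ρ (fun s => π s ω) t y

/-- The policies are those of the algorithm: the first one is arbitrary, and whenever the
constraint set of episode `t + 1` is not empty, `π (t + 1)` is a policy associated with a minimizer
of the objective over it. The losses `f t ω n` (which stands for `f_{t,n+1}`) may be chosen
adaptively; `g t ω n` is a (sub)gradient of `f t ω n`, and `h t ω` the gradient of `ψ`, at the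
current iterate. -/
structure IsMDPPK {N : ℕ} (p : Kernel X A N) (ρ : X × A → ℝ) (T : ℕ) (δ α η ℓ : ℝ)
    (ψ : Occ X A N → ℝ) (f : ℕ → Ω → Fin N → (X × A → ℝ) → ℝ) (g : ℕ → Ω → Fin N → X × A → ℝ)
    (h : ℕ → Ω → Occ X A N)
    (Z : ℕ → J → Ω → Traj X A N) (sel : ℕ → Ω → J) (π : ℕ → Ω → Policy X A N) : Prop where
  loss_convex : ∀ t < T, ∀ ω n, ConvexOn ℝ Set.univ (f t ω n)
  loss_lipschitz : ∀ t < T, ∀ ω n u v, |f t ω n u - f t ω n v| ≤ ℓ * l1 (u - v)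
  loss_grad : ∀ t < T, ∀ ω n, IsSubgradientAt (f t ω n) (g t ω n)
    (estOcc p ρ (observed Z sel ω) (fun s => π s ω) t n.succ)
  mirror_grad : ∀ t < T, ∀ ω,
    IsGradientAt ψ (h t ω) (estOcc p ρ (observed Z sel ω) (fun s => π s ω) t)
  update : ∀ t, t + 1 < T → ∀ ω,
    (feasibleSet p ρ T δ α (observed Z sel ω) (fun s => π s ω) (t + 1)).Nonempty →
      estOcc p ρ (observed Z sel ω) (fun s => π s ω) (t + 1) ∈
          feasibleSet p ρ T δ α (observed Z sel ω) (fun s => π s ω) (t + 1) ∧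
        IsMinOn
          (objective T δ η ℓ ψ (h t ω) (g t ω) (observed Z sel ω) t
            (estOcc p ρ (observed Z sel ω) (fun s => π s ω) t))
          (feasibleSet p ρ T δ α (observed Z sel ω) (fun s => π s ω) (t + 1))
          (estOcc p ρ (observed Z sel ω) (fun s => π s ω) (t + 1))

end PeriodicMDP

set_option linter.unusedSectionVars false

/-! The proof rests on a recursion over episodes. Suppose every row of `estKernel` lies within its
bonus of the true row in L₁. For a periodic policy started at ρ_t, the final marginal under p̂_t is
within ⟨μ, b_t⟩ of the one under p, by telescoping over the time steps; the latter is within α‖ρ_t -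
ρ‖₁ of ρ by contraction. So the constraint set is non-empty (`feasibleSet_nonempty`) and the iterate
μ_t obeys the constraint. Comparing ρ_{t+1} with the last marginal of μ_t costs ⟨μ_t, b_t⟩ once
more, hence ‖ρ_{t+1} - ρ‖₁ ≤ α‖ρ_t - ρ‖₁ + 2⟨μ_t, b_t⟩. Passing from p̂_t to p in the pairing costs
a factor 1 + N C_δ (`pairBonus_occ_le`), and summing over t produces 1/(1 - α)
(`sum_l1_initDist_sub_le`).

It remains to sum the bonuses expected under the true dynamics. They exceed the bonuses at the
observed pairs by an Azuma–Hoeffding term (`IsProtocol.prob_sum_bonus_lt_le`), and the observed ones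
add up to order C_δ √(|X||A|T) for each time step, because each visit lowers the next bonus at the
same pair (`sum_inv_sqrt_visits_le`).

Both probabilistic inputs come from `measureReal_le_prod_le`, Markov's inequality for an exponential
supermartingale. For the estimates, the L₁ error is a maximum of linear functionals over sign
vectors. For each sign vector, time step, pair and deterministic count m, a product over the first m
visits only is used, so that the exponent can be tuned to m although the number of visits is random.
A union bound gives failure probability 2δ for the estimates (`IsProtocol.prob_bonus_lt_le`) and δ
for the bonuses, and 3δ ≤ (2 + T)δ. -/

namespace PeriodicMDP

variable {X A J Ω : Type*} [Fintype X] [Fintype A] [DecidableEq X] [DecidableEq A]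

/-! ### Inhomogeneous chains on a finite set -/

section Chain

variable {S : Type*} [Fintype S]

/-- The marginals of the inhomogeneous chain with transition matrices `M` and initial vector `ν`. -/
def chain {N : ℕ} (M : Fin N → Matrix S S ℝ) (ν : S → ℝ) (n : Fin (N + 1)) : S → ℝ :=
  Fin.induction (motive := fun _ => S → ℝ) ν (fun i μ => μ ᵥ* M i) n

@[simp] lemma chain_zero {N : ℕ} (M : Fin N → Matrix S S ℝ) (ν : S → ℝ) : chain M ν 0 = ν := rfl

lemma chain_succ {N : ℕ} (M : Fin N → Matrix S S ℝ) (ν : S → ℝ) (i : Fin N) :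
    chain M ν i.succ = chain M ν i.castSucc ᵥ* M i := rfl

/-- `chain` grows at its end, whereas path sums are split at their start; this moves the first step
into the initial vector. -/
lemma chain_tail {N : ℕ} (M : Fin (N + 1) → Matrix S S ℝ) (ν : S → ℝ) (n : Fin (N + 1)) :
    chain M ν n.succ = chain (fun i => M i.succ) (ν ᵥ* M 0) n := by
  induction n using Fin.induction with
  | zero => rfl
  | succ i ih => rw [chain_succ, chain_succ, ← ih, Fin.succ_castSucc]

lemma sum_path_cons {N : ℕ} (H : (Fin (N + 2) → S) → ℝ) :
    ∑ z, H z = ∑ z : Fin (N + 1) → S, ∑ u, H (Fin.cons u z) := by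
  rw [← (Fin.consEquiv (fun _ : Fin (N + 2) => S)).sum_comp, Fintype.sum_prod_type_right]
  rfl

lemma sum_path {N : ℕ} (M : Fin N → Matrix S S ℝ) (hM : ∀ i u, ∑ v, M i u v = 1) (ν : S → ℝ) :
    ∑ z : Fin (N + 1) → S, ν (z 0) * ∏ i, M i (z i.castSucc) (z i.succ) = ∑ u, ν u := by
  induction N generalizing ν with
  | zero =>
    rw [← (Equiv.funUnique (Fin 1) S).symm.sum_comp]
    simp
  | succ N ih =>
    rw [sum_path_cons]
    have h := ih (fun i => M i.succ) (fun i u => hM i.succ u) (ν ᵥ* M 0)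
    have h2 : ∑ v, (ν ᵥ* M 0) v = ∑ u, ν u := by
      simp only [Matrix.vecMul, dotProduct]
      rw [Finset.sum_comm]
      simp [← Finset.mul_sum, hM]
    rw [← h2, ← h]
    refine Finset.sum_congr rfl fun z _ => ?_
    simp only [Fin.prod_univ_succ (n := N), Matrix.vecMul, dotProduct, Finset.sum_mul]
    refine Finset.sum_congr rfl fun u _ => ?_
    simp [Fin.cons_succ, mul_assoc]

/-- Induction on the length with arbitrary ν, not only distributions. If the marked transition is
the first one, G is absorbed into the weights and `sum_path` sums out the rest; otherwise one step
is pushed into ν. -/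
lemma sum_path_pair {N : ℕ} (M : Fin N → Matrix S S ℝ) (hM : ∀ i u, ∑ v, M i u v = 1)
    (ν : S → ℝ) (n : Fin N) (G : S → S → ℝ) :
    ∑ z : Fin (N + 1) → S, ν (z 0) * (∏ i, M i (z i.castSucc) (z i.succ)) *
      G (z n.castSucc) (z n.succ) = ∑ u, chain M ν n.castSucc u * ∑ v, M n u v * G u v := by
  induction N generalizing ν with
  | zero => exact n.elim0
  | succ N ih =>
    rw [sum_path_cons]
    refine Fin.cases ?_ (fun k => ?_) n
    · have h := sum_path (fun i => M i.succ) (fun i u => hM i.succ u)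
        (fun v => ∑ u, ν u * (M 0 u v * G u v))
      have h2 : ∑ v, ∑ u, ν u * (M 0 u v * G u v) = ∑ u, ν u * ∑ v, M 0 u v * G u v := by
        rw [Finset.sum_comm]
        simp [Finset.mul_sum]
      rw [Fin.castSucc_zero, chain_zero, ← h2, ← h]
      refine Finset.sum_congr rfl fun z _ => ?_
      simp only [Fin.prod_univ_succ (n := N), Finset.sum_mul]
      refine Finset.sum_congr rfl fun u _ => ?_
      simp [Fin.cons_succ]
      ring
    · have h := ih (fun i => M i.succ) (fun i u => hM i.succ u) (ν ᵥ* M 0) k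
      rw [← Fin.succ_castSucc, chain_tail, ← h]
      refine Finset.sum_congr rfl fun z _ => ?_
      simp only [Fin.prod_univ_succ (n := N), Matrix.vecMul, dotProduct, Finset.sum_mul]
      refine Finset.sum_congr rfl fun u _ => ?_
      rw [mul_assoc (ν u)]
      simp [Fin.cons_succ]

lemma chain_nonneg {N : ℕ} {M : Fin N → Matrix S S ℝ} (hM : ∀ i u v, 0 ≤ M i u v) {ν : S → ℝ}
    (hν : ∀ u, 0 ≤ ν u) (n : Fin (N + 1)) (u : S) : 0 ≤ chain M ν n u := by
  induction n using Fin.induction generalizing u with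
  | zero => exact hν u
  | succ i ih =>
    rw [chain_succ]
    exact Finset.sum_nonneg fun v _ => mul_nonneg (ih v) (hM i v u)

lemma sum_chain {N : ℕ} {M : Fin N → Matrix S S ℝ} (hM : ∀ i u, ∑ v, M i u v = 1) (ν : S → ℝ)
    (n : Fin (N + 1)) : ∑ u, chain M ν n u = ∑ u, ν u := by
  induction n using Fin.induction with
  | zero => rfl
  | succ i ih =>
    rw [chain_succ, ← ih]
    simp only [Matrix.vecMul, dotProduct]
    rw [Finset.sum_comm]
    simp [← Finset.mul_sum, hM]

end Chain

/-! ### The `L₁` norm -/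

section L1

variable {ι : Type*} [Fintype ι]

lemma l1_nonneg (v : ι → ℝ) : 0 ≤ l1 v := Finset.sum_nonneg fun _ _ => abs_nonneg _

lemma l1_add_le (u v : ι → ℝ) : l1 (u + v) ≤ l1 u + l1 v := by
  rw [l1, l1, l1, ← Finset.sum_add_distrib]
  exact Finset.sum_le_sum fun i _ => abs_add_le _ _

lemma l1_sub_comm (u v : ι → ℝ) : l1 (u - v) = l1 (v - u) :=
  Finset.sum_congr rfl fun _ _ => abs_sub_comm _ _

lemma l1_sub_le (u v w : ι → ℝ) : l1 (u - w) ≤ l1 (u - v) + l1 (v - w) := by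
  simpa using l1_add_le (u - v) (v - w)

lemma l1_of_mem_stdSimplex {v : ι → ℝ} (hv : v ∈ stdSimplex ℝ ι) : l1 v = 1 := by
  rw [l1, ← hv.2]
  exact Finset.sum_congr rfl fun i _ => abs_of_nonneg (hv.1 i)

lemma l1_sub_le_two {u v : ι → ℝ} (hu : u ∈ stdSimplex ℝ ι) (hv : v ∈ stdSimplex ℝ ι) :
    l1 (u - v) ≤ 2 := by
  have := l1_sub_le u 0 v
  rw [l1_sub_comm 0 v, sub_zero, sub_zero, l1_of_mem_stdSimplex hu, l1_of_mem_stdSimplex hv] at this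
  linarith

end L1

/-! ### Occupancy measures -/

section Occ

variable {N : ℕ}

lemma occ_eq_chain (p : Kernel X A N) (π : Policy X A N) (ν : X × A → ℝ) :
    occ p π ν = chain (stepMatrix p π) ν := rfl

lemma vecMul_partialMatrix (p : Kernel X A N) (π : Policy X A N) (ν : X × A → ℝ)
    (n : Fin (N + 1)) : ν ᵥ* partialMatrix p π n = occ p π ν n := by
  induction n using Fin.induction with
  | zero => exact Matrix.vecMul_one ν
  | succ i ih =>
    rw [occ_eq_chain, chain_succ, ← occ_eq_chain, ← ih, Matrix.vecMul_vecMul]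
    rfl

lemma vecMul_episodeMatrix (p : Kernel X A N) (π : Policy X A N) (ν : X × A → ℝ) :
    ν ᵥ* episodeMatrix p π = occ p π ν (Fin.last N) := vecMul_partialMatrix p π ν _

lemma stepMatrix_nonneg {p : Kernel X A N} (hp : ∀ n y x, 0 ≤ p n y x) {π : Policy X A N}
    (hπ : IsPolicy π) (n : Fin N) (y z : X × A) : 0 ≤ stepMatrix p π n y z :=
  mul_nonneg (hp n y z.1) ((hπ n z.1).1 z.2)

lemma sum_stepMatrix_mul (p : Kernel X A N) {π : Policy X A N} (hπ : IsPolicy π) (n : Fin N)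
    (y : X × A) (G : X → ℝ) : ∑ z, stepMatrix p π n y z * G z.1 = ∑ x, p n y x * G x := by
  rw [Fintype.sum_prod_type]
  refine Finset.sum_congr rfl fun x _ => ?_
  have : ∀ a, stepMatrix p π n y (x, a) * G x = p n y x * G x * π n x a := fun a => by
    simp only [stepMatrix, Matrix.of_apply]; ring
  simp only [this, ← Finset.mul_sum, (hπ n x).2, mul_one]

lemma sum_stepMatrix {p : Kernel X A N} (hp : IsKernel p) {π : Policy X A N} (hπ : IsPolicy π)
    (n : Fin N) (y : X × A) : ∑ z, stepMatrix p π n y z = 1 := by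
  have := sum_stepMatrix_mul p hπ n y (fun _ => 1)
  simpa [(hp n y).2] using this

lemma occ_nonneg {p : Kernel X A N} (hp : ∀ n y x, 0 ≤ p n y x) {π : Policy X A N}
    (hπ : IsPolicy π) {ν : X × A → ℝ} (hν : ∀ y, 0 ≤ ν y) (n : Fin (N + 1)) (y : X × A) :
    0 ≤ occ p π ν n y :=
  chain_nonneg (stepMatrix_nonneg hp hπ) hν n y

lemma occ_mem_stdSimplex {p : Kernel X A N} (hp : IsKernel p) {π : Policy X A N}
    (hπ : IsPolicy π) {ν : X × A → ℝ} (hν : ν ∈ stdSimplex ℝ (X × A)) (n : Fin (N + 1)) :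
    occ p π ν n ∈ stdSimplex ℝ (X × A) :=
  ⟨occ_nonneg (fun n y => (hp n y).1) hπ hν.1 n,
    (sum_chain (sum_stepMatrix hp hπ) ν n).trans hν.2⟩

lemma occ_mem_flowSet {p : Kernel X A N} (hp : ∀ n y x, 0 ≤ p n y x) {π : Policy X A N}
    (hπ : IsPolicy π) {ν : X × A → ℝ} (hν : ∀ y, 0 ≤ ν y) : occ p π ν ∈ flowSet p ν := by
  refine ⟨occ_nonneg hp hπ hν, rfl, fun n x => ?_⟩
  have : ∀ a, occ p π ν n.succ (x, a) = (∑ y, occ p π ν n.castSucc y * p n y x) * π n x a := by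
    intro a
    rw [Finset.sum_mul]
    exact Finset.sum_congr rfl fun y _ => (mul_assoc _ _ _).symm
  simp only [this, ← Finset.mul_sum, (hπ n x).2, mul_one]

/-- Substochastic rows suffice. This matters because an estimated row at an unvisited pair is zero
after the first episode. -/
lemma l1_vecMul_stepMatrix_le {p : Kernel X A N} (hp : ∀ n y x, 0 ≤ p n y x)
    (hp1 : ∀ n y, ∑ x, p n y x ≤ 1) {π : Policy X A N} (hπ : IsPolicy π) (n : Fin N)
    (v : X × A → ℝ) : l1 (v ᵥ* stepMatrix p π n) ≤ l1 v := by
  calc l1 (v ᵥ* stepMatrix p π n) ≤ ∑ z, ∑ y, |v y| * stepMatrix p π n y z := by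
        refine Finset.sum_le_sum fun z _ => (Finset.abs_sum_le_sum_abs _ _).trans_eq ?_
        refine Finset.sum_congr rfl fun y _ => ?_
        rw [abs_mul, abs_of_nonneg (stepMatrix_nonneg hp hπ n y z)]
    _ = ∑ y, |v y| * ∑ x, p n y x := by
        rw [Finset.sum_comm]
        refine Finset.sum_congr rfl fun y _ => ?_
        rw [← Finset.mul_sum]
        simpa using congrArg (|v y| * ·) (sum_stepMatrix_mul p hπ n y (fun _ => 1))
    _ ≤ l1 v := Finset.sum_le_sum fun y _ => mul_le_of_le_one_right (abs_nonneg _) (hp1 n y)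

lemma l1_vecMul_stepMatrix_sub_le (p q : Kernel X A N) {π : Policy X A N} (hπ : IsPolicy π)
    (n : Fin N) {v : X × A → ℝ} (hv : ∀ y, 0 ≤ v y) :
    l1 (v ᵥ* (stepMatrix p π n - stepMatrix q π n)) ≤ ∑ y, v y * l1 (p n y - q n y) := by
  have hd : ∀ z : X × A, (v ᵥ* (stepMatrix p π n - stepMatrix q π n)) z =
      ∑ y, v y * ((p n y z.1 - q n y z.1) * π n z.1 z.2) := fun z => by
    simp only [Matrix.vecMul, dotProduct, stepMatrix, Matrix.sub_apply, Matrix.of_apply, sub_mul]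
  calc l1 (v ᵥ* (stepMatrix p π n - stepMatrix q π n))
      ≤ ∑ z : X × A, ∑ y, v y * (|p n y z.1 - q n y z.1| * π n z.1 z.2) := by
        refine Finset.sum_le_sum fun z _ => ?_
        rw [hd]
        refine (Finset.abs_sum_le_sum_abs _ _).trans_eq (Finset.sum_congr rfl fun y _ => ?_)
        rw [abs_mul, abs_of_nonneg (hv y), abs_mul, abs_of_nonneg ((hπ n z.1).1 z.2)]
    _ = ∑ y, v y * l1 (p n y - q n y) := by
        rw [Finset.sum_comm]
        refine Finset.sum_congr rfl fun y _ => ?_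
        rw [← Finset.mul_sum]
        congr 1
        have h := sum_stepMatrix_mul (fun n y x => |p n y x - q n y x|) hπ n y (fun _ => 1)
        simp only [mul_one] at h
        exact h

/-- Two kernels and one policy: the occupancy measures differ by at most the accumulated
differences of the rows, weighted with the first occupancy measure. -/
lemma l1_occ_sub_occ_le {p q : Kernel X A N} (hp : ∀ n y x, 0 ≤ p n y x)
    (hq : ∀ n y x, 0 ≤ q n y x) (hq1 : ∀ n y, ∑ x, q n y x ≤ 1)
    {π : Policy X A N} (hπ : IsPolicy π) {ν : X × A → ℝ} (hν : ∀ y, 0 ≤ ν y) (n : Fin (N + 1)) :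
    l1 (occ p π ν n - occ q π ν n) ≤
      ∑ i : Fin N, if i.castSucc < n then ∑ y, occ p π ν i.castSucc y * l1 (p i y - q i y)
        else 0 := by
  induction n using Fin.induction with
  | zero =>
    simp [occ_eq_chain, l1]
  | succ k ih =>
    -- One new error, made from the marginal under p, plus the old error propagated by q, which does
    -- not expand L₁. Only q therefore needs a row bound, and only p supplies the weights.
    have h1 : occ p π ν k.succ - occ q π ν k.succ =
        occ p π ν k.castSucc ᵥ* (stepMatrix p π k - stepMatrix q π k) +
          (occ p π ν k.castSucc - occ q π ν k.castSucc) ᵥ* stepMatrix q π k := by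
      simp only [occ_eq_chain, chain_succ, Matrix.vecMul_sub, Matrix.sub_vecMul]
      abel
    rw [h1]
    refine (l1_add_le _ _).trans ((add_le_add
      (l1_vecMul_stepMatrix_sub_le p q hπ k (occ_nonneg hp hπ hν _))
      ((l1_vecMul_stepMatrix_le hq hq1 hπ k _).trans ih)).trans_eq ?_)
    have h2 : ∀ i : Fin N, (if i.castSucc < k.succ then
          ∑ y, occ p π ν i.castSucc y * l1 (p i y - q i y) else 0) =
        (if i = k then ∑ y, occ p π ν i.castSucc y * l1 (p i y - q i y) else 0) +
        if i.castSucc < k.castSucc then ∑ y, occ p π ν i.castSucc y * l1 (p i y - q i y)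
          else 0 := by
      intro i
      simp only [Fin.lt_def, Fin.ext_iff, Fin.val_castSucc, Fin.val_succ]
      split_ifs <;> first | omega | simp
    simp only [h2, Finset.sum_add_distrib, Finset.sum_ite_eq', Finset.mem_univ, if_true]

/-- The terms of time steps from n on are nonnegative, so one full pairing dominates the error at
every n at once. -/
lemma l1_occ_sub_occ_le_pairBonus {p q : Kernel X A N} (hp : ∀ n y x, 0 ≤ p n y x)
    (hq : ∀ n y x, 0 ≤ q n y x) (hq1 : ∀ n y, ∑ x, q n y x ≤ 1)
    {π : Policy X A N} (hπ : IsPolicy π) {ν : X × A → ℝ} (hν : ∀ y, 0 ≤ ν y)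
    {b : Fin N → X × A → ℝ} (hb : ∀ n y, l1 (p n y - q n y) ≤ b n y) (n : Fin (N + 1)) :
    l1 (occ p π ν n - occ q π ν n) ≤ pairBonus (occ p π ν) b := by
  refine (l1_occ_sub_occ_le hp hq hq1 hπ hν n).trans (Finset.sum_le_sum fun i _ => ?_)
  have h0 : ∀ y, 0 ≤ occ p π ν i.castSucc y := occ_nonneg hp hπ hν _
  split_ifs
  · exact Finset.sum_le_sum fun y _ => mul_le_mul_of_nonneg_left (hb i y) (h0 y)
  · exact Finset.sum_nonneg fun y _ => mul_nonneg (h0 y) ((l1_nonneg _).trans (hb i y))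

lemma initDist_succ (p : Kernel X A N) (ρ : X × A → ℝ) (π : ℕ → Policy X A N) (t : ℕ) :
    initDist p ρ π (t + 1) = occ p (π t) (initDist p ρ π t) (Fin.last N) :=
  vecMul_episodeMatrix p (π t) _

lemma initDist_mem_stdSimplex {p : Kernel X A N} (hp : IsKernel p) {ρ : X × A → ℝ}
    (hρ : ρ ∈ stdSimplex ℝ (X × A)) {π : ℕ → Policy X A N} {T : ℕ}
    (hπ : ∀ t < T, IsPolicy (π t)) {t : ℕ} (ht : t ≤ T) :
    initDist p ρ π t ∈ stdSimplex ℝ (X × A) := by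
  induction t with
  | zero => exact hρ
  | succ t ih =>
    rw [initDist_succ]
    exact occ_mem_stdSimplex hp (hπ t ht) (ih (by omega)) _

end Occ

/-! ### Counts -/

section Counts

variable {N : ℕ}

lemma sum_moves_mul (o : ℕ → Traj X A N) (t : ℕ) (n : Fin N) (y : X × A) (s : X → ℝ) :
    ∑ x, (moves o t n y x : ℝ) * s x =
      ∑ r ∈ Finset.range t, if o r n.castSucc = y then s (o r n.succ).1 else 0 := by
  simp only [moves, Finset.card_filter, Nat.cast_sum, Finset.sum_mul]
  rw [Finset.sum_comm]
  refine Finset.sum_congr rfl fun r _ => ?_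
  by_cases h : o r n.castSucc = y <;> simp [h]

lemma visits_eq_sum (o : ℕ → Traj X A N) (t : ℕ) (n : Fin N) (y : X × A) :
    (visits o t n y : ℝ) = ∑ r ∈ Finset.range t, if o r n.castSucc = y then 1 else 0 := by
  rw [visits, Finset.sum_boole]

lemma sum_moves (o : ℕ → Traj X A N) (t : ℕ) (n : Fin N) (y : X × A) :
    ∑ x, (moves o t n y x : ℝ) = visits o t n y := by
  simpa [visits_eq_sum] using sum_moves_mul o t n y (fun _ => 1)

lemma visits_succ (o : ℕ → Traj X A N) (t : ℕ) (n : Fin N) (y : X × A) :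
    visits o (t + 1) n y = visits o t n y + if o t n.castSucc = y then 1 else 0 := by
  simp only [visits, Finset.card_filter, Finset.sum_range_succ]

lemma visits_mono (o : ℕ → Traj X A N) (n : Fin N) (y : X × A) :
    Monotone fun t => visits o t n y :=
  monotone_nat_of_le_succ fun t => by rw [visits_succ]; omega

lemma visits_lt (o : ℕ → Traj X A N) {r t : ℕ} (hrt : r < t) {n : Fin N} {y : X × A}
    (h : o r n.castSucc = y) : visits o r n y < visits o t n y := by
  have h1 := visits_succ o r n y
  have h2 : visits o (r + 1) n y ≤ visits o t n y := visits_mono o n y hrt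
  rw [if_pos h] at h1
  omega

lemma sum_visits (o : ℕ → Traj X A N) (t : ℕ) (n : Fin N) :
    ∑ y, (visits o t n y : ℝ) = t := by
  simp only [visits_eq_sum]
  rw [Finset.sum_comm]
  simp

lemma visits_le (o : ℕ → Traj X A N) (t : ℕ) (n : Fin N) (y : X × A) : visits o t n y ≤ t :=
  (Finset.card_filter_le _ _).trans_eq (Finset.card_range t)

lemma estKernel_nonneg (o : ℕ → Traj X A N) (t : ℕ) (n : Fin N) (y : X × A) (x : X) :
    0 ≤ estKernel o t n y x := by
  unfold estKernel
  split_ifs <;> positivity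

lemma sum_estKernel_le_one (o : ℕ → Traj X A N) {t : ℕ} (ht : t ≠ 0) (n : Fin N) (y : X × A) :
    ∑ x, estKernel o t n y x ≤ 1 := by
  simp only [estKernel, if_neg ht, ← Finset.sum_div, sum_moves]
  exact div_le_one_of_le₀ (le_max_right _ _) (by positivity)

/-- For m ≥ 1 the difference of roots is 1/(√(m+1) + √m) with √(m+1) ≤ 2√m, hence the 3, which also
covers m = 0. -/
lemma inv_sqrt_max_le (m : ℕ) :
    1 / Real.sqrt (max 1 (m : ℝ)) ≤ 3 * Real.sqrt ((m : ℝ) + 1) - 3 * Real.sqrt m := by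
  rcases Nat.eq_zero_or_pos m with rfl | hm
  · norm_num
  · have hm1 : (1 : ℝ) ≤ m := by exact_mod_cast hm
    rw [max_eq_right hm1]
    have ha : 0 < Real.sqrt m := Real.sqrt_pos.2 (by linarith)
    have h1 : Real.sqrt ((m : ℝ) + 1) ≤ 2 * Real.sqrt m := by
      rw [Real.sqrt_le_left (by positivity), mul_pow, Real.sq_sqrt (by linarith)]
      linarith
    have h2 := Real.sq_sqrt (show (0 : ℝ) ≤ (m : ℝ) by linarith)
    have h3 := Real.sq_sqrt (show (0 : ℝ) ≤ (m : ℝ) + 1 by linarith)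
    have hb : Real.sqrt m ≤ Real.sqrt ((m : ℝ) + 1) := Real.sqrt_le_sqrt (by linarith)
    rw [div_le_iff₀ ha]
    have h4 : (Real.sqrt ((m : ℝ) + 1) - Real.sqrt m) * (Real.sqrt ((m : ℝ) + 1) + Real.sqrt m) = 1 := by
      nlinarith
    nlinarith

/-- The potential ∑_y 3√(visits of y) grows by at least the summand in every episode, since only the
observed pair gains a visit. As the final counts sum to T, Cauchy–Schwarz over the |X||A| pairs
finishes the bound. -/
lemma sum_inv_sqrt_visits_le (o : ℕ → Traj X A N) (T : ℕ) (n : Fin N) :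
    ∑ t ∈ Finset.range T, 1 / Real.sqrt (max 1 (visits o t n (o t n.castSucc) : ℝ)) ≤
      3 * Real.sqrt ((Fintype.card X : ℝ) * (Fintype.card A : ℝ) * T) := by
  have h1 : ∑ t ∈ Finset.range T, 1 / Real.sqrt (max 1 (visits o t n (o t n.castSucc) : ℝ)) ≤
      ∑ y, 3 * Real.sqrt (visits o T n y) := by
    induction T with
    | zero => simp [visits]
    | succ T ih =>
      rw [Finset.sum_range_succ]
      have h2 : ∑ y, 3 * Real.sqrt (visits o (T + 1) n y) - ∑ y, 3 * Real.sqrt (visits o T n y) =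
          3 * Real.sqrt ((visits o T n (o T n.castSucc) : ℝ) + 1) -
            3 * Real.sqrt (visits o T n (o T n.castSucc)) := by
        rw [← Finset.sum_sub_distrib, Finset.sum_eq_single (o T n.castSucc)]
        · simp [visits_succ]
        · intro y _ hy
          simp [visits_succ, hy.symm]
        · simp
      linarith [inv_sqrt_max_le (visits o T n (o T n.castSucc))]
  refine h1.trans ?_
  rw [← Finset.mul_sum]
  refine mul_le_mul_of_nonneg_left (Real.le_sqrt_of_sq_le ?_) (by norm_num)
  refine (sq_sum_le_card_mul_sum_sq).trans_eq ?_
  simp [Real.sq_sqrt, sum_visits]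

end Counts

/-! ### The recursion for the distance to the periodic distribution -/

section Recursion

variable {N : ℕ}

lemma bonus_nonneg (T : ℕ) (δ : ℝ) (o : ℕ → Traj X A N) (t : ℕ) (n : Fin N) (y : X × A) :
    0 ≤ bonus T δ o t n y :=
  div_nonneg (Real.sqrt_nonneg _) (Real.sqrt_nonneg _)

lemma bonus_le (T : ℕ) (δ : ℝ) (o : ℕ → Traj X A N) (t : ℕ) (n : Fin N) (y : X × A) :
    bonus T δ o t n y ≤ bonusConst X A N T δ :=
  div_le_self (Real.sqrt_nonneg _) (Real.one_le_sqrt.2 (le_max_left _ _))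

lemma pairBonus_nonneg {μ : Occ X A N} (hμ : ∀ n y, 0 ≤ μ n y) {b : Fin N → X × A → ℝ}
    (hb : ∀ n y, 0 ≤ b n y) : 0 ≤ pairBonus μ b :=
  Finset.sum_nonneg fun n _ => Finset.sum_nonneg fun y _ => mul_nonneg (hμ _ y) (hb n y)

/-- Changing the kernel multiplies the expected bonus by at most `1 + N B`, where `B` bounds the
bonus. -/
lemma pairBonus_occ_le {p q : Kernel X A N} (hp : ∀ n y x, 0 ≤ p n y x)
    (hq : ∀ n y x, 0 ≤ q n y x) (hq1 : ∀ n y, ∑ x, q n y x ≤ 1)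
    {π : Policy X A N} (hπ : IsPolicy π) {ν : X × A → ℝ} (hν : ∀ y, 0 ≤ ν y)
    {b : Fin N → X × A → ℝ} (hb : ∀ n y, l1 (p n y - q n y) ≤ b n y) {B : ℝ}
    (hbB : ∀ n y, b n y ≤ B) (hB : 0 ≤ B) :
    pairBonus (occ q π ν) b ≤ (1 + N * B) * pairBonus (occ p π ν) b := by
  have hb0 : ∀ n y, 0 ≤ b n y := fun n y => (l1_nonneg _).trans (hb n y)
  -- At each time step the bonus, which is at most B, is integrated against the difference of two
  -- marginals, itself at most the whole pairing under p.
  have h1 : ∀ n : Fin N, ∑ y, occ q π ν n.castSucc y * b n y ≤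
      ∑ y, occ p π ν n.castSucc y * b n y + B * pairBonus (occ p π ν) b := by
    intro n
    have h2 : B * l1 (occ p π ν n.castSucc - occ q π ν n.castSucc) ≤
        B * pairBonus (occ p π ν) b :=
      mul_le_mul_of_nonneg_left (l1_occ_sub_occ_le_pairBonus hp hq hq1 hπ hν hb _) hB
    refine le_trans ?_ (add_le_add_right h2 _)
    rw [l1, Finset.mul_sum, ← Finset.sum_add_distrib]
    refine Finset.sum_le_sum fun y _ => ?_
    have h3 := neg_abs_le (occ p π ν n.castSucc y - occ q π ν n.castSucc y)
    have h4 := mul_le_mul_of_nonneg_right (hbB n y)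
      (abs_nonneg (occ p π ν n.castSucc y - occ q π ν n.castSucc y))
    have h5 := mul_le_mul_of_nonneg_left h3 (hb0 n y)
    simp only [Pi.sub_apply]
    nlinarith
  calc pairBonus (occ q π ν) b
      ≤ ∑ n : Fin N, (∑ y, occ p π ν n.castSucc y * b n y + B * pairBonus (occ p π ν) b) :=
        Finset.sum_le_sum fun n _ => h1 n
    _ = (1 + N * B) * pairBonus (occ p π ν) b := by
        rw [Finset.sum_add_distrib, ← pairBonus]
        simp
        ring

/-- While the estimates are accurate, the occupancy measure of a periodic policy is feasible. -/
lemma feasibleSet_nonempty {p : Kernel X A N} (hp : IsKernel p) {ρ : X × A → ℝ}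
    (hρ : ρ ∈ stdSimplex ℝ (X × A)) {α : ℝ} (hfeas : ∃ π : Policy X A N, IsPeriodic p ρ π)
    (hcontr : PeriodicContraction p ρ α) {T : ℕ} {δ : ℝ} {o : ℕ → Traj X A N}
    {π : ℕ → Policy X A N} {t : ℕ} (hν : initDist p ρ π t ∈ stdSimplex ℝ (X × A))
    (hgood : ∀ n y, l1 (estKernel o t n y - p n y) ≤ bonus T δ o t n y) :
    (feasibleSet p ρ T δ α o π t).Nonempty := by
  obtain ⟨π₀, hπ₀⟩ := hfeas
  have h1 := hcontr π₀ hπ₀ _ hν ρ hρ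
  rw [hπ₀.2, vecMul_episodeMatrix] at h1
  refine ⟨occ (estKernel o t) π₀ (initDist p ρ π t),
    occ_mem_flowSet (estKernel_nonneg o t) hπ₀.1 hν.1, ?_⟩
  -- The intermediate point is the true final marginal of the periodic policy: estimation error on
  -- one side, contraction towards ρ = ρ P_π on the other.
  exact (l1_sub_le _ (occ p π₀ (initDist p ρ π t) (Fin.last N)) _).trans (add_le_add
    (l1_occ_sub_occ_le_pairBonus (estKernel_nonneg o t) (fun n y => (hp n y).1)
      (fun n y => (hp n y).2.le) hπ₀.1 hν.1 hgood _) h1)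

/-- The distance to the periodic distribution after an episode whose estimated occupancy measure is
feasible. -/
lemma l1_initDist_succ_sub_le {p : Kernel X A N} (hp : IsKernel p) {ρ : X × A → ℝ}
    {α : ℝ} {T : ℕ} {δ : ℝ} {o : ℕ → Traj X A N} {π : ℕ → Policy X A N} {t : ℕ} (ht : t ≠ 0)
    (hπ : IsPolicy (π t)) (hν : initDist p ρ π t ∈ stdSimplex ℝ (X × A))
    (hgood : ∀ n y, l1 (estKernel o t n y - p n y) ≤ bonus T δ o t n y)
    (hmem : estOcc p ρ o π t ∈ feasibleSet p ρ T δ α o π t) :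
    l1 (initDist p ρ π (t + 1) - ρ) ≤ α * l1 (initDist p ρ π t - ρ) +
      2 * (1 + N * bonusConst X A N T δ) *
        pairBonus (occ p (π t) (initDist p ρ π t)) (bonus T δ o t) := by
  have h1 := l1_sub_le (initDist p ρ π (t + 1)) (estOcc p ρ o π t (Fin.last N)) ρ
  have h2 : l1 (initDist p ρ π (t + 1) - estOcc p ρ o π t (Fin.last N)) ≤
      pairBonus (estOcc p ρ o π t) (bonus T δ o t) := by
    rw [initDist_succ, l1_sub_comm]
    exact l1_occ_sub_occ_le_pairBonus (estKernel_nonneg o t) (fun n y => (hp n y).1)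
      (fun n y => (hp n y).2.le) hπ hν.1 hgood _
  have h3 := pairBonus_occ_le (fun n y => (hp n y).1) (estKernel_nonneg o t)
    (sum_estKernel_le_one o ht) hπ hν.1
    (fun n y => (l1_sub_comm _ _).trans_le (hgood n y)) (bonus_le T δ o t) (Real.sqrt_nonneg _)
  have h4 := hmem.2
  rw [estOcc] at *
  linarith

/-- Summation of the recursion; the α-term is absorbed on the left after an index shift. The
additive 2 pays for the first episode, where neither the estimate nor the policy is controlled. -/
lemma sum_l1_initDist_sub_le {p : Kernel X A N} (hp : IsKernel p) {ρ : X × A → ℝ}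
    (hρ : ρ ∈ stdSimplex ℝ (X × A)) {α : ℝ} (hα : 0 ≤ α)
    (hfeas : ∃ π : Policy X A N, IsPeriodic p ρ π)
    (hcontr : PeriodicContraction p ρ α) {T : ℕ} {δ : ℝ} {o : ℕ → Traj X A N}
    {π : ℕ → Policy X A N} (hπ : ∀ t < T, IsPolicy (π t))
    (hgood : ∀ t < T, t ≠ 0 → ∀ n y, l1 (estKernel o t n y - p n y) ≤ bonus T δ o t n y)
    (hupd : ∀ t, t + 1 < T → (feasibleSet p ρ T δ α o π (t + 1)).Nonempty →
      estOcc p ρ o π (t + 1) ∈ feasibleSet p ρ T δ α o π (t + 1)) :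
    (1 - α) * ∑ t ∈ Finset.range T, l1 (initDist p ρ π (t + 1) - ρ) ≤
      2 + 2 * (1 + N * bonusConst X A N T δ) *
        ∑ t ∈ Finset.range T,
          pairBonus (occ p (π t) (initDist p ρ π t)) (bonus T δ o t) := by
  have hmem : ∀ t ≤ T, initDist p ρ π t ∈ stdSimplex ℝ (X × A) := fun t ht =>
    initDist_mem_stdSimplex hp hρ hπ ht
  have hK : 0 ≤ 2 * (1 + N * bonusConst X A N T δ) := by
    have : 0 ≤ bonusConst X A N T δ := Real.sqrt_nonneg _
    positivity
  have hU : ∀ t < T, 0 ≤ pairBonus (occ p (π t) (initDist p ρ π t)) (bonus T δ o t) :=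
    fun t ht => pairBonus_nonneg (occ_nonneg (fun n y => (hp n y).1) (hπ t ht) (hmem t ht.le).1)
      (bonus_nonneg T δ o t)
  have hstep : ∀ t < T, l1 (initDist p ρ π (t + 1) - ρ) ≤ (if t = 0 then 2 else 0) +
      (α * l1 (initDist p ρ π t - ρ) + 2 * (1 + N * bonusConst X A N T δ) *
        pairBonus (occ p (π t) (initDist p ρ π t)) (bonus T δ o t)) := by
    intro t ht
    rcases Nat.eq_zero_or_pos t with rfl | h0
    · have h1 := l1_sub_le_two (hmem 1 ht) hρ
      have h2 := mul_nonneg hK (hU 0 ht)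
      have h3 := mul_nonneg hα (l1_nonneg (initDist p ρ π 0 - ρ))
      simp only [if_true]
      linarith
    · obtain ⟨s, rfl⟩ := Nat.exists_eq_succ_of_ne_zero h0.ne'
      have hg := hgood _ ht h0.ne'
      simpa using l1_initDist_succ_sub_le hp h0.ne' (hπ _ ht) (hmem _ ht.le) hg
        (hupd s ht (feasibleSet_nonempty hp hρ hfeas hcontr (hmem _ ht.le) hg))
  have hsum := Finset.sum_le_sum fun t ht => hstep t (Finset.mem_range.1 ht)
  rw [Finset.sum_add_distrib, Finset.sum_add_distrib, ← Finset.mul_sum, ← Finset.mul_sum] at hsum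
  have h1 : ∑ t ∈ Finset.range T, (if t = 0 then (2 : ℝ) else 0) ≤ 2 := by
    rw [Finset.sum_ite_eq']
    split_ifs <;> norm_num
  -- The shift loses nothing because the first episode starts exactly at ρ.
  have h2 : ∑ t ∈ Finset.range T, l1 (initDist p ρ π t - ρ) ≤
      ∑ t ∈ Finset.range T, l1 (initDist p ρ π (t + 1) - ρ) := by
    have h3 := Finset.sum_range_succ (fun t => l1 (initDist p ρ π t - ρ)) T
    rw [Finset.sum_range_succ'] at h3
    have h4 : l1 (initDist p ρ π 0 - ρ) = 0 := by simp [initDist, l1]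
    linarith [l1_nonneg (initDist p ρ π T - ρ)]
  have h5 := mul_le_mul_of_nonneg_left h2 hα
  linarith

end Recursion

/-! ### Exponential inequalities -/

section Exponential

/-- Hoeffding's lemma for a distribution on a finite set. -/
lemma sum_mul_exp_le {S : Type*} [Fintype S] {w : S → ℝ} (hw : w ∈ stdSimplex ℝ S) {v : S → ℝ}
    {a b : ℝ} (hv : ∀ i, v i ∈ Set.Icc a b) (θ : ℝ) :
    ∑ i, w i * Real.exp (θ * (v i - ∑ j, w j * v j)) ≤ Real.exp ((b - a) ^ 2 / 8 * θ ^ 2) := by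
  -- The weights become a genuine probability measure, so that the sub-Gaussian bound for bounded
  -- variables applies.
  let _ : MeasurableSpace S := ⊤
  have h1 : ∑ i, ENNReal.ofReal (w i) = 1 := by
    rw [← ENNReal.ofReal_sum_of_nonneg fun i _ => hw.1 i, hw.2, ENNReal.ofReal_one]
  set μ := PMF.ofFintype (fun i => ENNReal.ofReal (w i)) h1 with hμ
  have hi : ∀ f : S → ℝ, ∫ i, f i ∂μ.toMeasure = ∑ i, w i * f i := fun f => by
    rw [PMF.integral_eq_sum]
    refine Finset.sum_congr rfl fun i _ => ?_
    rw [hμ, PMF.ofFintype_apply, ENNReal.toReal_ofReal (hw.1 i), smul_eq_mul]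
  have h2 := (hasSubgaussianMGF_of_mem_Icc (μ := μ.toMeasure) (X := v)
    (measurable_from_top.aemeasurable) (Filter.Eventually.of_forall hv)).mgf_le θ
  rw [mgf, hi, hi] at h2
  refine h2.trans_eq ?_
  congr 1
  push_cast
  rw [div_pow, Real.norm_eq_abs, sq_abs]
  ring

/-- Averaging over a variable with conditional law `q`. -/
lemma integral_comp_eq {S : Type*} [Fintype S] {m mΩ : MeasurableSpace Ω} (hm : m ≤ mΩ)
    {P : Measure Ω} [IsProbabilityMeasure P] {o : Ω → S}
    (ho : ∀ z, MeasurableSet {ω | o ω = z}) {q : Ω → S → ℝ}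
    (hq : ∀ z, P⟦{ω | o ω = z} | m⟧ =ᵐ[P] fun ω => q ω z) {F : Ω → S → ℝ}
    (hF : ∀ z, Measurable[m] fun ω => F ω z) {B : ℝ} (hB : ∀ ω z, |F ω z| ≤ B) :
    Integrable (fun ω => ∑ z, F ω z * q ω z) P ∧
      ∫ ω, F ω (o ω) ∂P = ∫ ω, ∑ z, F ω z * q ω z ∂P := by
  classical
  have hind : ∀ z, Integrable ({ω | o ω = z}.indicator fun _ => (1 : ℝ)) P := fun z =>
    (integrable_const 1).indicator (ho z)
  have hFm : ∀ z, StronglyMeasurable[m] fun ω => F ω z := fun z =>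
    Measurable.stronglyMeasurable (hF z)
  have hFb : ∀ (z : S) (g : Ω → ℝ), Integrable g P → Integrable (fun ω => F ω z * g ω) P :=
    fun z g hg => hg.bdd_mul (c := B) ((hFm z).mono hm).aestronglyMeasurable
      (Filter.Eventually.of_forall fun ω => hB ω z)
  have hq1 : ∀ z, Integrable (fun ω => q ω z) P := fun z =>
    integrable_condExp.congr (hq z)
  have hsum : ∀ ω, F ω (o ω) = ∑ z, F ω z * {ω | o ω = z}.indicator (fun _ => (1 : ℝ)) ω := by
    intro ω
    rw [Finset.sum_eq_single (o ω)]
    · simp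
    · intro z _ hz
      simp [hz.symm]
    · simp
  refine ⟨integrable_finsetSum _ fun z _ => hFb z _ (hq1 z), ?_⟩
  simp only [hsum]
  rw [integral_finsetSum _ fun z _ => hFb z _ (hind z),
    integral_finsetSum _ fun z _ => hFb z _ (hq1 z)]
  refine Finset.sum_congr rfl fun z _ => ?_
  rw [← integral_condExp hm]
  refine integral_congr_ae ?_
  refine (condExp_stronglyMeasurable_mul_of_bound hm (hFm z) (hind z) B
    (Filter.Eventually.of_forall fun ω => hB ω z)).trans ?_
  filter_upwards [hq z] with ω hω
  simp [hω]

/-- A product of nonnegative factors, each of which has conditional mean at most one, is large with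
small probability only. -/
lemma measureReal_le_prod_le {S : Type*} [Fintype S] {mΩ : MeasurableSpace Ω}
    {P : Measure Ω} [IsProbabilityMeasure P] (ℋ : Filtration ℕ mΩ) {T : ℕ} {o : ℕ → Ω → S}
    (ho : ∀ t ≤ T, ∀ s < t, ∀ z, MeasurableSet[ℋ t] {ω | o s ω = z}) {q : ℕ → Ω → S → ℝ}
    (hq : ∀ t < T, ∀ z, P⟦{ω | o t ω = z} | ℋ t⟧ =ᵐ[P] fun ω => q t ω z)
    {F : ℕ → Ω → S → ℝ} (hF : ∀ t < T, ∀ z, Measurable[ℋ t] fun ω => F t ω z)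
    (hF0 : ∀ t < T, ∀ ω z, 0 ≤ F t ω z) {B : ℝ} (hB : ∀ t < T, ∀ ω z, F t ω z ≤ B)
    (hqF : ∀ t < T, ∀ ω, ∑ z, F t ω z * q t ω z ≤ 1) {c : ℝ} (hc : 0 < c) :
    P.real {ω | c ≤ ∏ t ∈ Finset.range T, F t ω (o t ω)} ≤ 1 / c := by
  have hW0 : ∀ t ≤ T, ∀ ω, 0 ≤ ∏ s ∈ Finset.range t, F s ω (o s ω) := fun t ht ω =>
    Finset.prod_nonneg fun s hs => hF0 s (by have := Finset.mem_range.1 hs; omega) ω _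
  have hWB : ∀ t ≤ T, ∀ ω, ∏ s ∈ Finset.range t, F s ω (o s ω) ≤ B ^ t := fun t ht ω => by
    refine (Finset.prod_le_prod (g := fun _ => B) (fun s hs => ?_) fun s hs => ?_).trans_eq
      (by simp)
    · exact hF0 s (by have := Finset.mem_range.1 hs; omega) ω _
    · exact hB s (by have := Finset.mem_range.1 hs; omega) ω _
  have hWm : ∀ t ≤ T, Measurable[ℋ t] fun ω => ∏ s ∈ Finset.range t, F s ω (o s ω) := by
    classical
    intro t ht
    refine Finset.measurable_prod _ fun s hs => ?_
    have hst : s < t := Finset.mem_range.1 hs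
    have h1 : (fun ω => F s ω (o s ω)) = fun ω => ∑ z, if o s ω = z then F s ω z else 0 := by
      funext ω
      simp
    rw [h1]
    refine Finset.measurable_sum _ fun z _ => Measurable.ite (ho t ht s hst z) ?_ measurable_const
    exact (hF s (by omega) z).mono (ℋ.mono hst.le) le_rfl
  have hint : ∀ t ≤ T, Integrable (fun ω => ∏ s ∈ Finset.range t, F s ω (o s ω)) P := by
    intro t ht
    refine Integrable.of_bound (C := B ^ t)
      ((hWm t ht).mono (ℋ.le t) le_rfl).aestronglyMeasurable
      (Filter.Eventually.of_forall fun ω => ?_)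
    rw [Real.norm_of_nonneg (hW0 t ht ω)]
    exact hWB t ht ω
  have hle : ∀ t ≤ T, ∫ ω, ∏ s ∈ Finset.range t, F s ω (o s ω) ∂P ≤ 1 := by
    intro t
    induction t with
    | zero => intro _; simp
    | succ t ih =>
      intro ht
      simp only [Finset.prod_range_succ]
      have h1 := integral_comp_eq (ℋ.le t) (P := P) (o := o t)
        (fun z => ℋ.le (t + 1) _ (ho (t + 1) ht t (Nat.lt_succ_self t) z)) (hq t ht)
        (F := fun ω z => (∏ s ∈ Finset.range t, F s ω (o s ω)) * F t ω z)
        (fun z => (hWm t (by omega)).mul (hF t ht z)) (B := B ^ t * B) (fun ω z => by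
          rw [abs_of_nonneg (mul_nonneg (hW0 t (by omega) ω) (hF0 t ht ω z))]
          exact mul_le_mul (hWB t (by omega) ω) (hB t ht ω z) (hF0 t ht ω z)
            ((hW0 t (by omega) ω).trans (hWB t (by omega) ω)))
      rw [h1.2]
      -- After averaging over the newest outcome, its factor has conditional mean at most one and
      -- the integral falls back to the shorter product.
      refine (integral_mono h1.1 (hint t (by omega)) fun ω => ?_).trans (ih (by omega))
      simp only [mul_assoc, ← Finset.mul_sum]
      exact mul_le_of_le_one_right (hW0 t (by omega) ω) (hqF t ht ω)
  rw [le_div_iff₀ hc, mul_comm]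
  exact (mul_meas_ge_le_integral_of_nonneg (Filter.Eventually.of_forall (hW0 T le_rfl))
    (hint T le_rfl) c).trans (hle T le_rfl)

end Exponential

/-! ### Measurability of the learner's quantities -/

section Measurability

variable {N : ℕ} {mΩ : MeasurableSpace Ω}

lemma measurable_occ (p : Kernel X A N) {π : Ω → Policy X A N} (hπ : Measurable π)
    {ν : Ω → X × A → ℝ} (hν : ∀ y, Measurable fun ω => ν ω y) (n : Fin (N + 1)) (y : X × A) :
    Measurable fun ω => occ p (π ω) (ν ω) n y := by
  induction n using Fin.induction generalizing y with
  | zero => exact hν y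
  | succ i ih =>
    have h : ∀ ω, occ p (π ω) (ν ω) i.succ y =
      ∑ u, occ p (π ω) (ν ω) i.castSucc u * (p i u y.1 * π ω i y.1 y.2) := fun ω => rfl
    simp only [h]
    have hπ1 : Measurable fun ω => π ω i y.1 y.2 := by fun_prop
    exact Finset.measurable_sum _ fun u _ => (ih u).mul (measurable_const.mul hπ1)

lemma measurable_initDist (p : Kernel X A N) (ρ : X × A → ℝ) {π : ℕ → Ω → Policy X A N} {t : ℕ}
    (hπ : ∀ s < t, Measurable (π s)) (y : X × A) :
    Measurable fun ω => initDist p ρ (fun s => π s ω) t y := by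
  induction t generalizing y with
  | zero => exact measurable_const
  | succ t ih =>
    simp only [initDist_succ]
    exact measurable_occ p (hπ t (Nat.lt_succ_self t)) (fun y => ih (fun s hs => hπ s (by omega)) y) _ y

lemma measurable_visits {o : Ω → ℕ → Traj X A N} {t : ℕ}
    (ho : ∀ s < t, ∀ z, MeasurableSet {ω | o ω s = z}) (n : Fin N) (y : X × A) :
    Measurable fun ω => (visits (o ω) t n y : ℝ) := by
  simp only [visits_eq_sum]
  refine Finset.measurable_sum _ fun s hs => Measurable.ite ?_ measurable_const measurable_const
  have : {ω | o ω s n.castSucc = y} =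
      ⋃ z ∈ {z : Traj X A N | z n.castSucc = y}, {ω | o ω s = z} := by
    ext ω
    simp
  rw [this]
  exact MeasurableSet.biUnion (Set.to_countable _) fun z _ => ho s (Finset.mem_range.1 hs) z

end Measurability

/-! ### The conditional law of the observed trajectory -/

section Law

variable {N : ℕ}

lemma sum_pathProb_mul {p : Kernel X A N} (hp : IsKernel p) {π : Policy X A N} (hπ : IsPolicy π)
    (ν : X × A → ℝ) (n : Fin N) (G : X × A → X × A → ℝ) :
    ∑ z : Traj X A N, ν (z 0) * pathProb p π z * G (z n.castSucc) (z n.succ) =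
      ∑ u, occ p π ν n.castSucc u * ∑ v, stepMatrix p π n u v * G u v :=
  sum_path_pair (stepMatrix p π) (sum_stepMatrix hp hπ) ν n G

lemma sum_start_mul_pathProb {p : Kernel X A N} (hp : IsKernel p) {π : Policy X A N}
    (hπ : IsPolicy π) (y : X × A) :
    ∑ z : Traj X A N, (if y = z 0 then 1 else 0) * pathProb p π z = 1 := by
  have h := sum_path (stepMatrix p π) (sum_stepMatrix hp hπ) (fun u => if y = u then 1 else 0)
  rw [Finset.sum_ite_eq, if_pos (Finset.mem_univ y)] at h
  exact h

lemma pathProb_nonneg {p : Kernel X A N} (hp : IsKernel p) {π : Policy X A N} (hπ : IsPolicy π)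
    (z : Traj X A N) : 0 ≤ pathProb p π z :=
  Finset.prod_nonneg fun n _ => stepMatrix_nonneg (fun n y => (hp n y).1) hπ n _ _

lemma pathProb_le_one {p : Kernel X A N} (hp : IsKernel p) {π : Policy X A N} (hπ : IsPolicy π)
    (z : Traj X A N) : pathProb p π z ≤ 1 := by
  refine Finset.prod_le_one
    (fun n _ => stepMatrix_nonneg (fun n y => (hp n y).1) hπ n _ _) fun n _ => ?_
  rw [← sum_stepMatrix hp hπ n (z n.castSucc)]
  exact Finset.single_le_sum (f := fun v => stepMatrix p π n (z n.castSucc) v)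
    (fun v _ => stepMatrix_nonneg (fun n y => (hp n y).1) hπ n _ _) (Finset.mem_univ _)

lemma measurable_pathProb {mΩ : MeasurableSpace Ω} (p : Kernel X A N) {π : Ω → Policy X A N}
    (hπ : Measurable π) (z : Traj X A N) : Measurable fun ω => pathProb p (π ω) z := by
  refine Finset.measurable_prod _ fun n _ => ?_
  have hπ1 : Measurable fun ω => π ω n (z n.succ).1 (z n.succ).2 := by fun_prop
  exact measurable_const.mul hπ1

variable [Fintype J] {mΩ : MeasurableSpace Ω} {P : Measure Ω} [IsProbabilityMeasure P]
  {p : Kernel X A N} {ρ : X × A → ℝ} {T : ℕ} {ℱ 𝒢 : Filtration ℕ mΩ}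
  {Z : ℕ → J → Ω → Traj X A N} {sel : ℕ → Ω → J} {π : ℕ → Ω → Policy X A N}

/-- The moves of one agent during an episode, given all that is settled when it starts. -/
lemma IsProtocol.condProb_agent (hprot : IsProtocol P p ρ T ℱ 𝒢 Z sel π) (hp : IsKernel p)
    {t : ℕ} (ht : t < T) (j : J) (z : Traj X A N) :
    P⟦{ω | Z t j ω = z} | 𝒢 t⟧ =ᵐ[P]
      fun ω => (if Z t j ω 0 = z 0 then 1 else 0) * pathProb p (π t ω) z := by
  classical
  have hms : ∀ (j : J) (z : Traj X A N), MeasurableSet {ω | Z t j ω = z} := fun j z =>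
    𝒢.le (t + 1) _ (hprot.past_meas (t + 1) ht t (Nat.lt_succ_self t) j z)
  have hmsall : ∀ z : J → Traj X A N, MeasurableSet {ω | ∀ j, Z t j ω = z j} := fun z => by
    simp only [Set.ofPred_forall]
    exact MeasurableSet.iInter fun j => hms j (z j)
  have h1 : ({ω | Z t j ω = z}.indicator fun _ => (1 : ℝ)) =
      ∑ w ∈ Finset.univ.filter (fun w : J → Traj X A N => w j = z),
        {ω | ∀ i, Z t i ω = w i}.indicator fun _ => (1 : ℝ) := by
    funext ω
    rw [Finset.sum_apply]
    simp only [Set.indicator_apply, Set.mem_ofPred_eq, ← funext_iff (f := fun i => Z t i ω)]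
    rw [Finset.sum_ite_eq]
    simp
  rw [h1]
  refine (condExp_finsetSum (fun w _ => (integrable_const 1).indicator (hmsall w)) _).trans ?_
  have h2 : ∀ᵐ ω ∂P, ∀ w : J → Traj X A N, (P⟦{ω | ∀ i, Z t i ω = w i} | 𝒢 t⟧) ω =
      Set.indicator {ω | ∀ i, Z t i ω 0 = w i 0} (fun ω => ∏ i, pathProb p (π t ω) (w i)) ω :=
    ae_all_iff.2 fun w => hprot.move t ht w
  filter_upwards [h2] with ω hω
  rw [Finset.sum_apply]
  simp only [hω, Set.indicator_apply, Set.mem_ofPred_eq]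
  have h3 : ∀ w : J → Traj X A N,
      (if ∀ i, Z t i ω 0 = w i 0 then ∏ i, pathProb p (π t ω) (w i) else 0) =
        ∏ i, ((if Z t i ω 0 = w i 0 then 1 else 0) * pathProb p (π t ω) (w i)) := by
    intro w
    rw [Finset.prod_mul_distrib, Finset.prod_boole]
    simp
  -- Fixing the path of one agent leaves a product set, so the joint sum factorizes and every other
  -- agent contributes total mass one.
  have h4 : Finset.univ.filter (fun w : J → Traj X A N => w j = z) =
      Fintype.piFinset fun i => if i = j then {z} else Finset.univ := by
    ext w
    simp only [Finset.mem_filter, Finset.mem_univ, true_and, Fintype.mem_piFinset]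
    constructor
    · intro h i
      split_ifs with hi
      · rw [hi, h, Finset.mem_singleton]
      · exact Finset.mem_univ _
    · intro h
      simpa using h j
  simp only [h3]
  rw [h4, ← Finset.prod_univ_sum (fun i => if i = j then {z} else Finset.univ)
    (fun i w => (if Z t i ω 0 = w 0 then 1 else 0) * pathProb p (π t ω) w),
    Finset.prod_eq_single j]
  · simp
  · intro i _ hi
    rw [if_neg hi]
    exact sum_start_mul_pathProb hp (hprot.policy t ht ω) _
  · simp

/-- The observed trajectory, given all that is settled when the episode starts. -/
lemma IsProtocol.condProb_observed (hprot : IsProtocol P p ρ T ℱ 𝒢 Z sel π) (hp : IsKernel p)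
    {t : ℕ} (ht : t < T) (z : Traj X A N) :
    P⟦{ω | observed Z sel ω t = z} | 𝒢 t⟧ =ᵐ[P]
      fun ω => (if observed Z sel ω t 0 = z 0 then 1 else 0) * pathProb p (π t ω) z := by
  classical
  have hms : ∀ (j : J), MeasurableSet {ω | Z t j ω = z} := fun j =>
    𝒢.le (t + 1) _ (hprot.past_meas (t + 1) ht t (Nat.lt_succ_self t) j z)
  have hint : ∀ j, Integrable ({ω | Z t j ω = z}.indicator fun _ => (1 : ℝ)) P := fun j =>
    (integrable_const 1).indicator (hms j)
  have hsel : ∀ j, StronglyMeasurable[𝒢 t] ({ω | sel t ω = j}.indicator fun _ => (1 : ℝ)) :=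
    fun j => (stronglyMeasurable_const).indicator (hprot.sel_meas t ht j)
  have hb : ∀ j, ∀ᵐ ω ∂P, ‖({ω | sel t ω = j}.indicator fun _ => (1 : ℝ)) ω‖ ≤ 1 := fun j =>
    Filter.Eventually.of_forall fun ω => by
      rw [Set.indicator_apply]
      split_ifs <;> simp
  have h1 : ({ω | observed Z sel ω t = z}.indicator fun _ => (1 : ℝ)) =
      ∑ j, ({ω | sel t ω = j}.indicator fun _ => (1 : ℝ)) *
        {ω | Z t j ω = z}.indicator fun _ => (1 : ℝ) := by
    funext ω
    rw [Finset.sum_apply, Finset.sum_eq_single (sel t ω)]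
    · simp [Set.indicator_apply, observed]
    · intro j _ hj
      simp [hj.symm]
    · simp
  rw [h1]
  refine (condExp_finsetSum (fun j _ => (hint j).bdd_mul (c := 1)
    ((hsel j).mono (𝒢.le t)).aestronglyMeasurable (hb j)) _).trans ?_
  have h2 : ∀ᵐ ω ∂P, ∀ j, (P[({ω | sel t ω = j}.indicator fun _ => (1 : ℝ)) *
        {ω | Z t j ω = z}.indicator fun _ => (1 : ℝ) | 𝒢 t]) ω =
      (({ω | sel t ω = j}.indicator fun _ => (1 : ℝ)) * (P⟦{ω | Z t j ω = z} | 𝒢 t⟧)) ω :=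
    ae_all_iff.2 fun j => condExp_stronglyMeasurable_mul_of_bound (𝒢.le t) (hsel j) (hint j) 1 (hb j)
  have h3 := ae_all_iff.2 fun j => hprot.condProb_agent hp ht j z
  filter_upwards [h2, h3] with ω hω2 hω3
  rw [Finset.sum_apply, Finset.sum_eq_single (sel t ω)]
  · refine (hω2 _).trans ?_
    rw [Pi.mul_apply, hω3]
    by_cases h : Z t (sel t ω) ω 0 = z 0 <;> simp [observed, h]
  · intro j _ hj
    refine (hω2 j).trans ?_
    simp [hj.symm]
  · simp

/-- The observed trajectory, given the information of the learner. -/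
lemma IsProtocol.condProb_observed_info (hprot : IsProtocol P p ρ T ℱ 𝒢 Z sel π)
    (hp : IsKernel p) {t : ℕ} (ht : t < T) (z : Traj X A N) :
    P⟦{ω | observed Z sel ω t = z} | ℱ t⟧ =ᵐ[P]
      fun ω => initDist p ρ (fun s => π s ω) t (z 0) * pathProb p (π t ω) z := by
  have hst : MeasurableSet {ω | Z t (sel t ω) ω 0 = z 0} := by
    have : {ω | Z t (sel t ω) ω 0 = z 0} =
        ⋃ j, {ω | sel t ω = j} ∩ {ω | Z t j ω 0 = z 0} := by
      ext ω
      simp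
    rw [this]
    exact MeasurableSet.iUnion fun j => (𝒢.le t _ (hprot.sel_meas t ht j)).inter
      (𝒢.le t _ (hprot.start_meas t ht j (z 0)))
  have hpath : StronglyMeasurable[ℱ t] fun ω => pathProb p (π t ω) z :=
    Measurable.stronglyMeasurable (measurable_pathProb p (hprot.policy_meas t ht) z)
  -- Tower property: condition on 𝒢 first, where the start is known, then average the start over ℱ,
  -- under which it has law ρ_t.
  have h1 := (condExp_condExp_of_le (f := {ω | observed Z sel ω t = z}.indicator fun _ => (1 : ℝ))
    (μ := P) (hprot.info_le t ht.le) (𝒢.le t)).symm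
  refine h1.trans ((condExp_congr_ae (hprot.condProb_observed hp ht z)).trans ?_)
  have h2 : (fun ω => (if observed Z sel ω t 0 = z 0 then 1 else 0) * pathProb p (π t ω) z) =
      (fun ω => pathProb p (π t ω) z) *
        {ω | Z t (sel t ω) ω 0 = z 0}.indicator fun _ => (1 : ℝ) := by
    funext ω
    by_cases h : Z t (sel t ω) ω 0 = z 0 <;> simp [observed, h]
  rw [h2]
  refine (condExp_stronglyMeasurable_mul_of_bound (ℱ.le t) hpath
    ((integrable_const 1).indicator hst) 1 (Filter.Eventually.of_forall fun ω => ?_)).trans ?_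
  · rw [Real.norm_of_nonneg (pathProb_nonneg hp (hprot.policy t ht ω) z)]
    exact pathProb_le_one hp (hprot.policy t ht ω) z
  · filter_upwards [hprot.indep t ht (z 0)] with ω hω
    rw [Pi.mul_apply, hω, mul_comm]

/-! ### The two exponential inequalities of the protocol -/

/-- Visits after the first m contribute the factor 1, so m, and any θ tuned to it, stays
deterministic. Given 𝒢 the path starts from a point mass, but a move out of y follows the row of p
at y whatever the start, so Hoeffding's lemma keeps each conditional mean at most one. -/
lemma IsProtocol.prob_transitions_le (hprot : IsProtocol P p ρ T ℱ 𝒢 Z sel π) (hp : IsKernel p)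
    (n : Fin N) (y : X × A) (m : ℕ) {s : X → ℝ} (hs : ∀ x, s x ∈ Set.Icc (-1 : ℝ) 1) (θ : ℝ)
    {c : ℝ} (hc : 0 < c) :
    P.real {ω | c ≤ ∏ t ∈ Finset.range T,
      if observed Z sel ω t n.castSucc = y ∧ visits (observed Z sel ω) t n y < m then
        Real.exp (θ * (s (observed Z sel ω t n.succ).1 - ∑ x, p n y x * s x) - θ ^ 2 / 2)
      else 1} ≤ 1 / c := by
  have hom : ∀ t ≤ T, ∀ r < t, ∀ z, MeasurableSet[𝒢 t] {ω | observed Z sel ω r = z} :=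
    fun t ht r hr z => hprot.info_le t ht _ (hprot.observed_meas t ht r hr z)
  refine measureReal_le_prod_le 𝒢 (o := fun t ω => observed Z sel ω t) hom
    (fun t ht => hprot.condProb_observed hp ht)
    (F := fun t ω z => if z n.castSucc = y ∧ visits (observed Z sel ω) t n y < m then
      Real.exp (θ * (s (z n.succ).1 - ∑ x, p n y x * s x) - θ ^ 2 / 2) else 1)
    (B := ∑ x, Real.exp (θ * (s x - ∑ x, p n y x * s x) - θ ^ 2 / 2) + 1)
    (fun t ht z => ?_) (fun t ht ω z => ?_) (fun t ht ω z => ?_) (fun t ht ω => ?_) hc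
  · refine Measurable.ite ?_ measurable_const measurable_const
    by_cases hz : z n.castSucc = y
    · have hv : Measurable[𝒢 t] fun ω => (visits (observed Z sel ω) t n y : ℝ) :=
        measurable_visits (mΩ := 𝒢 t) (fun r hr z => hom t ht.le r hr z) n y
      have h1 : {ω | z n.castSucc = y ∧ visits (observed Z sel ω) t n y < m} =
          (fun ω => (visits (observed Z sel ω) t n y : ℝ)) ⁻¹' Set.Iio (m : ℝ) := by
        ext ω
        simp [hz]
      rw [h1]
      exact hv measurableSet_Iio
    · simp [hz]
  · split_ifs <;> positivity
  · have h0 : ∀ x, 0 ≤ Real.exp (θ * (s x - ∑ x, p n y x * s x) - θ ^ 2 / 2) :=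
      fun x => (Real.exp_pos _).le
    split_ifs
    · have := Finset.single_le_sum (fun x _ => h0 x) (Finset.mem_univ (z n.succ).1)
      linarith
    · have := Finset.sum_nonneg fun x (_ : x ∈ Finset.univ) => h0 x
      linarith
  · have hπ := hprot.policy t ht ω
    have h1 := sum_pathProb_mul hp hπ (fun u => if observed Z sel ω t 0 = u then 1 else 0) n
      (fun u v => if u = y ∧ visits (observed Z sel ω) t n y < m then
        Real.exp (θ * (s v.1 - ∑ x, p n y x * s x) - θ ^ 2 / 2) else 1)
    simp only [mul_comm _ ((if observed Z sel ω t 0 = _ then (1 : ℝ) else 0) * _)]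
    rw [h1]
    have h2 : ∀ u, ∑ v, stepMatrix p (π t ω) n u v *
        (if u = y ∧ visits (observed Z sel ω) t n y < m then
          Real.exp (θ * (s v.1 - ∑ x, p n y x * s x) - θ ^ 2 / 2) else 1) ≤ 1 := by
      intro u
      split_ifs with h
      · rw [sum_stepMatrix_mul p hπ n u
          (fun x => Real.exp (θ * (s x - ∑ x, p n y x * s x) - θ ^ 2 / 2)), h.1]
        simp only [Real.exp_sub _ (θ ^ 2 / 2), mul_div_assoc', ← Finset.sum_div]
        rw [div_le_one (Real.exp_pos _)]
        -- The range [-1, 1] has length 2, and 2²/8 = 1/2 matches the compensator θ²/2.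
        refine (sum_mul_exp_le (hp n y) hs θ).trans_eq ?_
        congr 1
        ring
      · simp [sum_stepMatrix hp hπ]
    have hν : (fun u => if observed Z sel ω t 0 = u then (1 : ℝ) else 0) ∈
        stdSimplex ℝ (X × A) :=
      ⟨fun u => by dsimp only; split_ifs <;> norm_num, by simp⟩
    have h3 := occ_mem_stdSimplex hp hπ hν n.castSucc
    exact (Finset.sum_le_sum fun u _ => mul_le_of_le_one_right (h3.1 u) (h2 u)).trans h3.2.le

/-- Conditioning is on ℱ here: given ℱ the observed agent starts from ρ_t, so the conditional mean
of its bonus is the sum against the true occupancy measure. Hoeffding's lemma is applied to bonuses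
in [0, C_δ]. -/
lemma IsProtocol.prob_bonus_le (hprot : IsProtocol P p ρ T ℱ 𝒢 Z sel π) (hp : IsKernel p)
    (hρ : ρ ∈ stdSimplex ℝ (X × A)) (δ : ℝ) (n : Fin N) (θ : ℝ) {c : ℝ} (hc : 0 < c) :
    P.real {ω | c ≤ ∏ t ∈ Finset.range T, Real.exp (θ *
      (∑ y, occ p (π t ω) (initDist p ρ (fun s => π s ω) t) n.castSucc y *
          bonus T δ (observed Z sel ω) t n y -
        bonus T δ (observed Z sel ω) t n (observed Z sel ω t n.castSucc)) -
      bonusConst X A N T δ ^ 2 / 8 * θ ^ 2)} ≤ 1 / c := by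
  have hocc : ∀ t < T, ∀ ω, occ p (π t ω) (initDist p ρ (fun s => π s ω) t) n.castSucc ∈
      stdSimplex ℝ (X × A) := fun t ht ω => occ_mem_stdSimplex hp (hprot.policy t ht ω)
        (initDist_mem_stdSimplex hp hρ (fun s hs => hprot.policy s hs ω) ht.le) _
  have hIcc : ∀ t ω y, bonus T δ (observed Z sel ω) t n y ∈ Set.Icc 0 (bonusConst X A N T δ) :=
    fun t ω y => ⟨bonus_nonneg _ _ _ _ _ _, bonus_le _ _ _ _ _ _⟩
  refine measureReal_le_prod_le ℱ (o := fun t ω => observed Z sel ω t) hprot.observed_meas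
    (fun t ht => hprot.condProb_observed_info hp ht)
    (F := fun t ω z => Real.exp (θ *
      (∑ y, occ p (π t ω) (initDist p ρ (fun s => π s ω) t) n.castSucc y *
          bonus T δ (observed Z sel ω) t n y -
        bonus T δ (observed Z sel ω) t n (z n.castSucc)) -
      bonusConst X A N T δ ^ 2 / 8 * θ ^ 2))
    (B := Real.exp (|θ| * bonusConst X A N T δ))
    (fun t ht z => ?_) (fun t ht ω z => (Real.exp_pos _).le) (fun t ht ω z => ?_)
    (fun t ht ω => ?_) hc
  · have hb : ∀ y, Measurable[ℱ t] fun ω => bonus T δ (observed Z sel ω) t n y := fun y => by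
      have := measurable_visits (mΩ := ℱ t)
        (fun r hr z => hprot.observed_meas t ht.le r hr z) n y
      exact ((measurable_const.max this).sqrt).const_div _
    have ho : ∀ y, Measurable[ℱ t] fun ω =>
        occ p (π t ω) (initDist p ρ (fun s => π s ω) t) n.castSucc y := fun y =>
      measurable_occ (mΩ := ℱ t) p (hprot.policy_meas t ht) (fun y =>
        measurable_initDist (mΩ := ℱ t) p ρ (fun s hs =>
          (hprot.policy_meas s (hs.trans ht)).mono (ℱ.mono hs.le) le_rfl) y) _ y
    exact Real.measurable_exp.comp ((((Finset.measurable_sum _ fun y _ =>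
      (ho y).mul (hb y)).sub (hb _)).const_mul θ).sub_const _)
  · refine Real.exp_le_exp.2 ?_
    have h1 : |∑ y, occ p (π t ω) (initDist p ρ (fun s => π s ω) t) n.castSucc y *
          bonus T δ (observed Z sel ω) t n y -
        bonus T δ (observed Z sel ω) t n (z n.castSucc)| ≤ bonusConst X A N T δ := by
      have h2 : 0 ≤ ∑ y, occ p (π t ω) (initDist p ρ (fun s => π s ω) t) n.castSucc y *
          bonus T δ (observed Z sel ω) t n y :=
        Finset.sum_nonneg fun y _ => mul_nonneg ((hocc t ht ω).1 y) (hIcc t ω y).1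
      have h3 : ∑ y, occ p (π t ω) (initDist p ρ (fun s => π s ω) t) n.castSucc y *
          bonus T δ (observed Z sel ω) t n y ≤ bonusConst X A N T δ := by
        calc _ ≤ ∑ y, occ p (π t ω) (initDist p ρ (fun s => π s ω) t) n.castSucc y *
              bonusConst X A N T δ := Finset.sum_le_sum fun y _ =>
                mul_le_mul_of_nonneg_left (hIcc t ω y).2 ((hocc t ht ω).1 y)
          _ = _ := by rw [← Finset.sum_mul, (hocc t ht ω).2, one_mul]
      have h4 := hIcc t ω (z n.castSucc)
      exact abs_le.2 ⟨by linarith [h4.2], by linarith [h4.1]⟩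
    have h5 := (le_abs_self _).trans_eq (abs_mul θ _) |>.trans
      (mul_le_mul_of_nonneg_left h1 (abs_nonneg θ))
    have h6 : 0 ≤ bonusConst X A N T δ ^ 2 / 8 * θ ^ 2 := by positivity
    linarith
  · have hπ := hprot.policy t ht ω
    have h1 := sum_pathProb_mul hp hπ (initDist p ρ (fun s => π s ω) t) n
      (fun u _ => Real.exp (θ *
      (∑ y, occ p (π t ω) (initDist p ρ (fun s => π s ω) t) n.castSucc y *
          bonus T δ (observed Z sel ω) t n y -
        bonus T δ (observed Z sel ω) t n u) -
      bonusConst X A N T δ ^ 2 / 8 * θ ^ 2))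
    simp only [← Finset.sum_mul, sum_stepMatrix hp hπ, one_mul] at h1
    simp only [mul_comm (Real.exp _)]
    rw [h1]
    -- The sign is reversed because the deviation is mean minus observation.
    have h2 := sum_mul_exp_le (hocc t ht ω) (hIcc t ω) (-θ)
    simp only [Real.exp_sub _ (bonusConst X A N T δ ^ 2 / 8 * θ ^ 2), mul_div_assoc',
      ← Finset.sum_div]
    rw [div_le_one (Real.exp_pos _)]
    refine (le_of_eq_of_le (Finset.sum_congr rfl fun u _ => ?_) h2).trans_eq ?_
    · congr 2
      ring
    · congr 1
      ring

end Law

/-! ### The estimation error -/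

section Deviation

variable {N : ℕ}

/-- The sign encoded by a Boolean. -/
def boolSign (b : Bool) : ℝ := if b then 1 else -1

lemma boolSign_mem (b : Bool) : boolSign b ∈ Set.Icc (-1 : ℝ) 1 := by
  cases b <;> norm_num [boolSign]

lemma boolSign_decide_mul (u v : ℝ) : (u - v) * boolSign (decide (v ≤ u)) = |u - v| := by
  by_cases h : v ≤ u
  · simp [boolSign, h, abs_of_nonneg]
  · simp [boolSign, h, abs_of_nonpos (sub_nonpos.2 (not_le.1 h).le)]

lemma estKernel_of_visits_eq_zero {o : ℕ → Traj X A N} {t : ℕ} (ht : t ≠ 0) {n : Fin N}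
    {y : X × A} (h : visits o t n y = 0) : estKernel o t n y = 0 := by
  funext x
  have h1 := sum_moves o t n y
  rw [h, Nat.cast_zero, Finset.sum_eq_zero_iff_of_nonneg fun _ _ => Nat.cast_nonneg _] at h1
  simp [estKernel, ht, h1 x (Finset.mem_univ x)]

lemma moves_eq_visits_mul_estKernel {o : ℕ → Traj X A N} {t : ℕ} (ht : t ≠ 0) {n : Fin N}
    {y : X × A} (h : 1 ≤ visits o t n y) (x : X) :
    (moves o t n y x : ℝ) = visits o t n y * estKernel o t n y x := by
  have h1 : (1 : ℝ) ≤ visits o t n y := by exact_mod_cast h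
  rw [estKernel, if_neg ht, max_eq_right h1]
  field_simp

/-- With m equal to the number of visits before t, stopping by count coincides with stopping at time
t. -/
lemma prod_transitions_eq (o : ℕ → Traj X A N) {t T : ℕ} (htT : t ≤ T) (n : Fin N) (y : X × A)
    (s : X → ℝ) :
    ∏ r ∈ Finset.range T, (if o r n.castSucc = y ∧ visits o r n y < visits o t n y then
      Real.exp (s (o r n.succ).1) else 1) = Real.exp (∑ x, (moves o t n y x : ℝ) * s x) := by
  rw [sum_moves_mul, Real.exp_sum]
  rw [← Finset.prod_subset (Finset.range_mono htT)]
  · refine Finset.prod_congr rfl fun r hr => ?_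
    by_cases h : o r n.castSucc = y
    · simp [h, visits_lt o (Finset.mem_range.1 hr) h]
    · simp [h]
  · intro r _ hr
    rw [Finset.mem_range, not_lt] at hr
    rw [if_neg]
    exact fun h => absurd (visits_mono o n y hr) (not_le.2 h.2)

/-- A large estimation error makes one of the exponential products large. -/
lemma exists_sign_of_bonus_lt {p : Kernel X A N} (hp : IsKernel p) {T : ℕ} {δ : ℝ}
    (hC : 1 ≤ bonusConst X A N T δ) (o : ℕ → Traj X A N) {t : ℕ} (htT : t ≤ T) (ht : t ≠ 0)
    {n : Fin N} {y : X × A} (h : bonus T δ o t n y < l1 (estKernel o t n y - p n y)) :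
    ∃ s : X → Bool, Real.exp (bonusConst X A N T δ ^ 2 / 2) ≤ ∏ r ∈ Finset.range T,
      if o r n.castSucc = y ∧ visits o r n y < visits o t n y then
        Real.exp (bonusConst X A N T δ / Real.sqrt (visits o t n y) *
          (boolSign (s (o r n.succ).1) - ∑ x, p n y x * boolSign (s x)) -
            (bonusConst X A N T δ / Real.sqrt (visits o t n y)) ^ 2 / 2)
      else 1 := by
  rcases Nat.eq_zero_or_pos (visits o t n y) with h0 | h0
  -- At an unvisited pair the estimated row is zero, so the error is exactly 1, while the bonus is
  -- C_δ ≥ 1: a contradiction.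
  · rw [estKernel_of_visits_eq_zero ht h0, l1_sub_comm, sub_zero,
      l1_of_mem_stdSimplex (hp n y), bonus, h0] at h
    norm_num at h
    linarith
  · have hm : (1 : ℝ) ≤ visits o t n y := by exact_mod_cast h0
    rw [bonus, max_eq_right hm] at h
    set m : ℝ := (visits o t n y : ℝ) with hmdef
    set θ := bonusConst X A N T δ / Real.sqrt m with hθ
    have hθ0 : 0 ≤ θ := div_nonneg (Real.sqrt_nonneg _) (Real.sqrt_nonneg _)
    have hθ2 : m * θ ^ 2 = bonusConst X A N T δ ^ 2 := by
      rw [hθ, div_pow, Real.sq_sqrt (by linarith)]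
      field_simp
    refine ⟨fun x => decide (p n y x ≤ estKernel o t n y x), ?_⟩
    set s : X → ℝ := fun x => boolSign (decide (p n y x ≤ estKernel o t n y x)) with hs
    rw [prod_transitions_eq o htT n y (fun x => θ * (s x - ∑ x, p n y x * s x) - θ ^ 2 / 2)]
    refine Real.exp_le_exp.2 ?_
    have h1 : l1 (estKernel o t n y - p n y) =
        ∑ x, estKernel o t n y x * s x - ∑ x, p n y x * s x := by
      rw [← Finset.sum_sub_distrib]
      refine Finset.sum_congr rfl fun x _ => ?_
      rw [← sub_mul, hs, boolSign_decide_mul, Pi.sub_apply]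
    have h2 : ∑ x, (moves o t n y x : ℝ) * (θ * (s x - ∑ x, p n y x * s x) - θ ^ 2 / 2) =
        θ * (m * ∑ x, estKernel o t n y x * s x) -
          (θ * ∑ x, p n y x * s x + θ ^ 2 / 2) * ∑ x, (moves o t n y x : ℝ) := by
      generalize ∑ x, p n y x * s x = S
      rw [Finset.mul_sum, Finset.mul_sum, Finset.mul_sum, ← Finset.sum_sub_distrib]
      refine Finset.sum_congr rfl fun x _ => ?_
      rw [moves_eq_visits_mul_estKernel ht h0]
      ring
    rw [h2, sum_moves, ← hmdef]
    -- Here θ = C_δ/√m equals the bonus itself, so the exponent is at least mθ² - mθ²/2 = C_δ²/2.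
    have h3 : θ * m * θ ≤ θ * m * l1 (estKernel o t n y - p n y) :=
      mul_le_mul_of_nonneg_left h.le (mul_nonneg hθ0 (by linarith))
    rw [h1] at h3
    nlinarith

variable [Fintype J] {mΩ : MeasurableSpace Ω} {P : Measure Ω} [IsProbabilityMeasure P]
  {p : Kernel X A N} {ρ : X × A → ℝ} {T : ℕ} {ℱ 𝒢 : Filtration ℕ mΩ}
  {Z : ℕ → J → Ω → Traj X A N} {sel : ℕ → Ω → J} {π : ℕ → Ω → Policy X A N}

lemma measureReal_iUnion_le_card_mul {ι : Type*} [Fintype ι] (B : ι → Set Ω) {r : ℝ}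
    (hB : ∀ i, P.real (B i) ≤ r) : P.real (⋃ i, B i) ≤ Fintype.card ι * r := by
  refine (measureReal_iUnion_fintype_le B).trans ((Finset.sum_le_sum fun i _ => hB i).trans_eq ?_)
  simp

/-- With high probability all estimates are accurate. -/
lemma IsProtocol.prob_bonus_lt_le (hprot : IsProtocol P p ρ T ℱ 𝒢 Z sel π) (hp : IsKernel p)
    {δ : ℝ} (hC : 1 ≤ bonusConst X A N T δ) :
    P.real {ω | ∃ t < T, t ≠ 0 ∧ ∃ n y, bonus T δ (observed Z sel ω) t n y <
        l1 (estKernel (observed Z sel ω) t n y - p n y)} ≤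
      2 ^ Fintype.card X *
        ((Fintype.card X : ℝ) * (Fintype.card A : ℝ) * (N : ℝ) * (T : ℝ)) *
        (1 / Real.exp (bonusConst X A N T δ ^ 2 / 2)) := by
  have h1 := measureReal_iUnion_le_card_mul (P := P)
    (fun i : (X → Bool) × Fin N × (X × A) × Fin T =>
      {ω | Real.exp (bonusConst X A N T δ ^ 2 / 2) ≤ ∏ r ∈ Finset.range T,
        if observed Z sel ω r i.2.1.castSucc = i.2.2.1 ∧
            visits (observed Z sel ω) r i.2.1 i.2.2.1 < (i.2.2.2 : ℕ) then
          Real.exp (bonusConst X A N T δ / Real.sqrt (i.2.2.2 : ℕ) *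
            (boolSign (i.1 (observed Z sel ω r i.2.1.succ).1) -
              ∑ x, p i.2.1 i.2.2.1 x * boolSign (i.1 x)) -
              (bonusConst X A N T δ / Real.sqrt (i.2.2.2 : ℕ)) ^ 2 / 2)
        else 1})
    (fun i => hprot.prob_transitions_le hp i.2.1 i.2.2.1 i.2.2.2
      (fun x => boolSign_mem (i.1 x)) _ (Real.exp_pos _))
  refine (measureReal_mono ?_).trans (h1.trans_eq ?_)
  · rintro ω ⟨t, htT, ht, n, y, h⟩
    obtain ⟨s, hs⟩ := exists_sign_of_bonus_lt hp hC (observed Z sel ω) htT.le ht h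
    -- Fewer than T visits precede an episode t < T, so T values of the count suffice in the union
    -- bound.
    exact Set.mem_iUnion.2 ⟨(s, n, y, ⟨visits (observed Z sel ω) t n y,
      (visits_le _ t n y).trans_lt htT⟩), hs⟩
  · simp only [Fintype.card_prod, Fintype.card_fun, Fintype.card_bool, Fintype.card_fin]
    push_cast
    ring

/-- With high probability the expected bonuses are not much larger than the observed ones. -/
lemma IsProtocol.prob_sum_bonus_lt_le (hprot : IsProtocol P p ρ T ℱ 𝒢 Z sel π)
    (hp : IsKernel p) (hρ : ρ ∈ stdSimplex ℝ (X × A)) (hN : 0 < N) (hT : 0 < T) {δ : ℝ}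
    (hδ0 : 0 < δ) (hδ1 : δ < 1) (hC : 1 ≤ bonusConst X A N T δ) :
    P.real {ω | ∃ n, ∑ t ∈ Finset.range T,
          bonus T δ (observed Z sel ω) t n (observed Z sel ω t n.castSucc) +
        bonusConst X A N T δ * Real.sqrt (T * Real.log (N / δ) / 2) <
      ∑ t ∈ Finset.range T, ∑ y, occ p (π t ω) (initDist p ρ (fun s => π s ω) t) n.castSucc y *
          bonus T δ (observed Z sel ω) t n y} ≤ δ := by
  set C := bonusConst X A N T δ with hCdef
  set a := C * Real.sqrt (T * Real.log (N / δ) / 2) with ha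
  -- This maximizes θa - T C²θ²/8; the choice of a makes the maximum equal to log(N/δ).
  set θ := 4 * a / (C ^ 2 * T) with hθ
  have hN1 : (1 : ℝ) ≤ N := by exact_mod_cast hN
  have hT0 : (0 : ℝ) < T := by exact_mod_cast hT
  have hNδ : 1 ≤ (N : ℝ) / δ := by rw [one_le_div hδ0]; linarith
  have ha2 : a ^ 2 = C ^ 2 * (T * Real.log (N / δ) / 2) := by
    rw [ha, mul_pow, Real.sq_sqrt]
    have := Real.log_nonneg hNδ
    positivity
  have ha0 : 0 ≤ a := by positivity
  have hθ0 : 0 ≤ θ := by positivity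
  have hθa : θ * a - T * (C ^ 2 / 8 * θ ^ 2) = Real.log (N / δ) := by
    have h1 : θ * a - T * (C ^ 2 / 8 * θ ^ 2) = 2 * a ^ 2 / (C ^ 2 * T) := by
      rw [hθ]
      field_simp
      ring
    rw [h1, ha2]
    field_simp
  have h1 := measureReal_iUnion_le_card_mul (P := P) (fun n : Fin N =>
      {ω | (N : ℝ) / δ ≤ ∏ t ∈ Finset.range T, Real.exp (θ *
        (∑ y, occ p (π t ω) (initDist p ρ (fun s => π s ω) t) n.castSucc y *
            bonus T δ (observed Z sel ω) t n y -
          bonus T δ (observed Z sel ω) t n (observed Z sel ω t n.castSucc)) -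
        C ^ 2 / 8 * θ ^ 2)})
    (fun n => hprot.prob_bonus_le hp hρ δ n θ (by positivity))
  refine (measureReal_mono ?_).trans (h1.trans_eq ?_)
  · rintro ω ⟨n, hn⟩
    refine Set.mem_iUnion.2 ⟨n, ?_⟩
    change (N : ℝ) / δ ≤ _
    rw [← Real.exp_sum, ← Real.log_le_iff_le_exp (by positivity), Finset.sum_sub_distrib,
      ← Finset.mul_sum, Finset.sum_sub_distrib, Finset.sum_const, Finset.card_range,
      nsmul_eq_mul, ← hθa]
    exact sub_le_sub_right (mul_le_mul_of_nonneg_left (by linarith) hθ0) _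
  · rw [Fintype.card_fin]
    field_simp

end Deviation

/-! ### The regret of the initial distributions -/

section Final

variable {N : ℕ}

/-- Combines, for each time step, the deviation term with the pathwise bound on observed bonuses;
the N time steps give the factor N. -/
lemma sum_pairBonus_le {p : Kernel X A N} {ρ : X × A → ℝ} {T : ℕ} {δ : ℝ}
    {o : ℕ → Traj X A N} {π : ℕ → Policy X A N} {a : ℝ}
    (h : ∀ n, ∑ t ∈ Finset.range T, ∑ y, occ p (π t) (initDist p ρ π t) n.castSucc y *
        bonus T δ o t n y ≤
      ∑ t ∈ Finset.range T, bonus T δ o t n (o t n.castSucc) + bonusConst X A N T δ * a) :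
    ∑ t ∈ Finset.range T, pairBonus (occ p (π t) (initDist p ρ π t)) (bonus T δ o t) ≤
      N * (bonusConst X A N T δ *
        (3 * Real.sqrt ((Fintype.card X : ℝ) * (Fintype.card A : ℝ) * T) + a)) := by
  have hC : 0 ≤ bonusConst X A N T δ := Real.sqrt_nonneg _
  simp only [pairBonus]
  rw [Finset.sum_comm]
  refine (Finset.sum_le_sum fun n _ => (h n).trans (?_ : _ ≤ bonusConst X A N T δ *
    (3 * Real.sqrt ((Fintype.card X : ℝ) * (Fintype.card A : ℝ) * T) + a))).trans_eq (by simp)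
  rw [mul_add]
  refine add_le_add_left ?_ _
  refine le_trans (le_of_eq ?_) (mul_le_mul_of_nonneg_left (sum_inv_sqrt_visits_le o T n) hC)
  rw [Finset.mul_sum]
  exact Finset.sum_congr rfl fun t _ => by rw [bonus, mul_one_div]

/-- The union bound over signs, time steps, state-action pairs and counts. -/
lemma two_pow_mul_div_exp_le {k : ℕ} (hk : 1 ≤ k) {K δ : ℝ} (hδ0 : 0 < δ)
    (hK : 2 * δ ≤ K) : 2 ^ k * K * (1 / Real.exp (k * Real.log (K / δ))) ≤ 2 * δ := by
  obtain ⟨j, rfl⟩ := Nat.exists_eq_add_of_le' hk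
  have hK0 : 0 < K := by linarith
  rw [Real.exp_nat_mul, Real.exp_log (by positivity)]
  have h1 : 2 ^ (j + 1) * K * (1 / (K / δ) ^ (j + 1)) = 2 * δ * (2 * δ / K) ^ j := by
    rw [div_pow, div_pow, mul_pow]
    field_simp
    ring
  rw [h1]
  exact mul_le_of_le_one_right (by positivity)
    (pow_le_one₀ (by positivity) ((div_le_one hK0).2 hK))

/-- The numerical estimate behind the constant `30`. -/
lemma bound_le_thirty {N x a T L G C : ℝ} (hN : 1 ≤ N) (hx : 1 ≤ x) (haT : 1 ≤ a * T)
    (haT' : T ≤ a * T) (hL : 1 ≤ L) (hG : 1 ≤ G)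
    (hC : C = Real.sqrt (2 * x * L)) :
    2 + 2 * (1 + N * C) * (N * (C * (3 * Real.sqrt (x * a * T) + Real.sqrt (T * G / 2)))) ≤
      30 * N ^ 2 * x ^ (3 / 2 : ℝ) * Real.sqrt (a * T) * L * Real.sqrt G := by
  have hxL : 1 ≤ x * L := one_le_mul_of_one_le_of_one_le hx hL
  have hC2 : C ^ 2 = 2 * (x * L) := by
    rw [hC, Real.sq_sqrt (by positivity)]
    ring
  have hC0 : 0 ≤ C := hC ▸ Real.sqrt_nonneg _
  -- 1.415 exceeds √2, and √(xL) ≤ xL since xL ≥ 1; likewise 0.71 below exceeds 1/√2.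
  have hC1 : C ≤ 1.415 * (x * L) := by
    refine abs_le_of_sq_le_sq' ?_ (by positivity) |>.2
    rw [hC2]
    nlinarith
  set w := Real.sqrt x with hw
  set v := Real.sqrt (a * T) with hv
  set g := Real.sqrt G with hg
  have hw1 : 1 ≤ w := Real.one_le_sqrt.2 hx
  have hv1 : 1 ≤ v := Real.one_le_sqrt.2 haT
  have hg1 : 1 ≤ g := Real.one_le_sqrt.2 hG
  have hx32 : x ^ (3 / 2 : ℝ) = x * w := by
    rw [hw, Real.sqrt_eq_rpow, ← Real.rpow_one_add' (by linarith) (by norm_num)]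
    norm_num
  have hxa : Real.sqrt (x * a * T) = w * v := by
    rw [mul_assoc, Real.sqrt_mul (by linarith)]
  have hTG : Real.sqrt (T * G / 2) ≤ 0.71 * (v * g) := by
    rw [Real.sqrt_le_left (by positivity), mul_pow, mul_pow, hv, hg,
      Real.sq_sqrt (by linarith), Real.sq_sqrt (by linarith)]
    have := mul_le_mul_of_nonneg_right haT' (by linarith : (0 : ℝ) ≤ G)
    nlinarith
  have hwvg : 1 ≤ w * v * g :=
    one_le_mul_of_one_le_of_one_le (one_le_mul_of_one_le_of_one_le hw1 hv1) hg1
  have hS : 3 * Real.sqrt (x * a * T) + Real.sqrt (T * G / 2) ≤ 3.71 * (w * v * g) := by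
    rw [hxa]
    have h1 : w * v ≤ w * v * g := le_mul_of_one_le_right (by positivity) hg1
    have h2 : v * g ≤ w * v * g := by
      rw [mul_assoc]
      exact le_mul_of_one_le_left (by positivity) hw1
    linarith
  have hNC : (1 + N * C) * (N * C) ≤ 3.415 * (N ^ 2 * (x * L)) := by
    have h1 : N * C ≤ N ^ 2 * (1.415 * (x * L)) :=
      mul_le_mul (by nlinarith) hC1 hC0 (by positivity)
    have h2 : (N * C) * (N * C) = N ^ 2 * (2 * (x * L)) := by
      rw [← hC2]
      ring
    linarith
  have hD : 1 ≤ N ^ 2 * (x * L) * (w * v * g) :=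
    one_le_mul_of_one_le_of_one_le (one_le_mul_of_one_le_of_one_le (one_le_pow₀ hN) hxL) hwvg
  have hmain : (1 + N * C) * (N * C) *
      (3 * Real.sqrt (x * a * T) + Real.sqrt (T * G / 2)) ≤
      3.415 * (N ^ 2 * (x * L)) * (3.71 * (w * v * g)) :=
    mul_le_mul hNC hS (by positivity) (by positivity)
  calc 2 + 2 * (1 + N * C) * (N * (C * (3 * Real.sqrt (x * a * T) + Real.sqrt (T * G / 2))))
      = 2 + 2 * ((1 + N * C) * (N * C) *
          (3 * Real.sqrt (x * a * T) + Real.sqrt (T * G / 2))) := by ring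
    -- 2 + 2 · 3.415 · 3.71 < 28, the additive 2 being absorbed because the product is at least 1.
    _ ≤ 30 * (N ^ 2 * (x * L) * (w * v * g)) := by linarith
    _ = 30 * N ^ 2 * x ^ (3 / 2 : ℝ) * v * L * g := by
        rw [hx32]
        ring

end Final

end PeriodicMDP

/-! ### Assembly: union bound over the two bad events. -/

theorem mainTheorem5 {X A J Ω : Type*} [Fintype X] [Fintype A] [DecidableEq X] [DecidableEq A]
    [Fintype J] {mΩ : MeasurableSpace Ω} (P : MeasureTheory.Measure Ω)
    [MeasureTheory.IsProbabilityMeasure P]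
    (N T : ℕ) (hN : 0 < N) (hT : 0 < T)
    (p : PeriodicMDP.Kernel X A N) (hp : PeriodicMDP.IsKernel p)
    (ρ : X × A → ℝ) (hρ : ρ ∈ stdSimplex ℝ (X × A))
    (α : ℝ) (hα0 : 0 ≤ α) (hα1 : α < 1)
    (hfeas : ∃ π : PeriodicMDP.Policy X A N, PeriodicMDP.IsPeriodic p ρ π)
    (hcontr : PeriodicMDP.PeriodicContraction p ρ α)
    (δ : ℝ) (hδ0 : 0 < δ) (hδ1 : δ < 1) (η : ℝ) (hη : 0 < η) (ℓ : ℝ)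
    (ψ : PeriodicMDP.Occ X A N → ℝ)
    (f : ℕ → Ω → Fin N → (X × A → ℝ) → ℝ) (g : ℕ → Ω → Fin N → X × A → ℝ)
    (h : ℕ → Ω → PeriodicMDP.Occ X A N)
    (ℱ 𝒢 : MeasureTheory.Filtration ℕ mΩ)
    (Z : ℕ → J → Ω → PeriodicMDP.Traj X A N) (sel : ℕ → Ω → J)
    (π : ℕ → Ω → PeriodicMDP.Policy X A N)
    (hprot : PeriodicMDP.IsProtocol P p ρ T ℱ 𝒢 Z sel π)
    (halg : PeriodicMDP.IsMDPPK p ρ T δ α η ℓ ψ f g h Z sel π) :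
    1 - (2 + (T : ℝ)) * δ ≤ P.real {ω |
      ∑ t ∈ Finset.range T,
          PeriodicMDP.l1 (PeriodicMDP.initDist p ρ (fun s => π s ω) (t + 1) - ρ) ≤
        30 * (N : ℝ) ^ 2 / (1 - α) * (Fintype.card X : ℝ) ^ (3 / 2 : ℝ) *
          Real.sqrt ((Fintype.card A : ℝ) * (T : ℝ)) *
          Real.log ((Fintype.card X : ℝ) * (Fintype.card A : ℝ) * (N : ℝ) * (T : ℝ) / δ) *
          Real.sqrt (Real.log ((N : ℝ) / δ))} := by
  have hNpos : (0 : ℝ) < N := by exact_mod_cast hN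
  have hTpos : (0 : ℝ) < T := by exact_mod_cast hT
  have hN1 : (1 : ℝ) ≤ N := by exact_mod_cast hN
  have hT1 : (1 : ℝ) ≤ T := by exact_mod_cast hT
  -- For δ ≥ 1/3 the claimed probability is at most 0, as T ≥ 1. For smaller δ, e < 3 makes all the
  -- logarithms at least 1.
  by_cases hδ3 : 1 / 3 ≤ δ
  · refine le_trans ?_ MeasureTheory.measureReal_nonneg
    nlinarith
  push Not at hδ3
  obtain ⟨y₀⟩ : Nonempty (X × A) := by
    by_contra hne
    rw [not_nonempty_iff] at hne
    simpa using hρ.2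
  have hX : 1 ≤ Fintype.card X := Fintype.card_pos_iff.2 ⟨y₀.1⟩
  have hA : 1 ≤ Fintype.card A := Fintype.card_pos_iff.2 ⟨y₀.2⟩
  have hX1 : (1 : ℝ) ≤ Fintype.card X := by exact_mod_cast hX
  have hA1 : (1 : ℝ) ≤ Fintype.card A := by exact_mod_cast hA
  set K : ℝ := (Fintype.card X : ℝ) * (Fintype.card A : ℝ) * (N : ℝ) * (T : ℝ) with hK
  have hK1 : 1 ≤ K := one_le_mul_of_one_le_of_one_le (one_le_mul_of_one_le_of_one_le
    (one_le_mul_of_one_le_of_one_le hX1 hA1) hN1) hT1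
  have hlog : ∀ u : ℝ, 1 ≤ u → 1 ≤ Real.log (u / δ) := by
    intro u hu
    rw [Real.le_log_iff_exp_le (by positivity)]
    refine Real.exp_one_lt_three.le.trans ?_
    rw [le_div_iff₀ hδ0]
    linarith
  have hL := hlog K hK1
  have hG := hlog N hN1
  have hCeq : PeriodicMDP.bonusConst X A N T δ =
    Real.sqrt (2 * (Fintype.card X : ℝ) * Real.log (K / δ)) := rfl
  have hC1 : 1 ≤ PeriodicMDP.bonusConst X A N T δ := by
    rw [hCeq, Real.one_le_sqrt]
    nlinarith
  have hbad₁ := hprot.prob_bonus_lt_le hp hC1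
  have hC2 : PeriodicMDP.bonusConst X A N T δ ^ 2 / 2 =
      (Fintype.card X : ℝ) * Real.log (K / δ) := by
    rw [hCeq, Real.sq_sqrt (by positivity)]
    ring
  rw [← hK, hC2] at hbad₁
  replace hbad₁ := hbad₁.trans (PeriodicMDP.two_pow_mul_div_exp_le hX hδ0 (by linarith))
  have hbad₂ := hprot.prob_sum_bonus_lt_le hp hρ hN hT hδ0 hδ1 hC1
  refine le_trans ?_ (sub_le_iff_le_add.2 ?_ : 1 - 3 * δ ≤ _)
  · nlinarith
  refine (MeasureTheory.probReal_univ (μ := P)).symm.trans_le ?_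
  refine le_trans ?_ (add_le_add_right
    ((add_le_add hbad₁ hbad₂).trans_eq (by ring : 2 * δ + δ = 3 * δ)) _)
  -- The whole space is covered by the claimed event and the two bad events.
  refine le_trans (MeasureTheory.measureReal_mono ?_) ((MeasureTheory.measureReal_union_le _ _).trans
    (add_le_add_right (MeasureTheory.measureReal_union_le _ _) _))
  intro ω _
  by_cases h1 : ∃ t < T, t ≠ 0 ∧ ∃ n y,
      PeriodicMDP.bonus T δ (PeriodicMDP.observed Z sel ω) t n y <
        PeriodicMDP.l1 (PeriodicMDP.estKernel (PeriodicMDP.observed Z sel ω) t n y - p n y)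
  · exact Or.inr (Or.inl h1)
  by_cases h2 : ∃ n, ∑ t ∈ Finset.range T,
          PeriodicMDP.bonus T δ (PeriodicMDP.observed Z sel ω) t n
            (PeriodicMDP.observed Z sel ω t n.castSucc) +
        PeriodicMDP.bonusConst X A N T δ * Real.sqrt (T * Real.log (N / δ) / 2) <
      ∑ t ∈ Finset.range T, ∑ y, PeriodicMDP.occ p (π t ω)
        (PeriodicMDP.initDist p ρ (fun s => π s ω) t) n.castSucc y *
          PeriodicMDP.bonus T δ (PeriodicMDP.observed Z sel ω) t n y
  · exact Or.inr (Or.inr h2)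
  refine Or.inl ?_
  push Not at h1 h2
  have h3 := PeriodicMDP.sum_l1_initDist_sub_le hp hρ hα0 hfeas hcontr
    (fun t ht => hprot.policy t ht ω) h1 (fun t ht hne => (halg.update t ht ω hne).1)
  have h4 := PeriodicMDP.sum_pairBonus_le h2
  have h5 := PeriodicMDP.bound_le_thirty hN1 hX1 (one_le_mul_of_one_le_of_one_le hA1 hT1)
    (le_mul_of_one_le_left hTpos.le hA1) hL hG hCeq
  have h6 : 0 ≤ 2 * (1 + N * PeriodicMDP.bonusConst X A N T δ) := by positivity
  have h7 := h3.trans ((add_le_add_right (mul_le_mul_of_nonneg_left h4 h6) 2).trans h5)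
  have h8 : 0 < 1 - α := by linarith
  rw [Set.mem_ofPred_eq]
  rw [mul_comm, ← le_div_iff₀ h8] at h7
  refine h7.trans_eq ?_
  ring
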